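/- Let $(M,\langle\cdot,\cdot\rangle)$ be a connected, non-compact smooth Riemannian manifold (not necessarily complete) of dimension $m\ge 2$. Write $\mathbb R^+=(0,\infty)$, $\mathbb R^+_0=[0,\infty)$, and let $$\varphi\in C(\mathbb R^+_0),\quad \varphi(0)=0,\quad \varphi>0 \text{ on } \mathbb R^+;\qquad b\in C(M),\quad b>0 \text{ on } M;\qquad l\in C(\mathbb R^+_0),\quad l>0\text{ on }\mathbb R^+ .$$ For $f\in C(\mathbb R)$ and $\Omega\subset M$ open, a $\mathrm{Lip}_{\rm loc}$ solution on $\Omega$ of $$(P_\ge)\qquad \Delta_\varphi u=\mathrm{div}\Big(\frac{\varphi(|\nabla u|)}{|\nabla u|}\nabla u\Big)\ \ge\ b(x)f(u)\,l(|\nabla u|)$$ is a function $u\in \mathrm{Lip}_{\rm loc}(\Omega)$ such that, for every $0\le\psi\in C^\infty_c(\Omega)$, $$-\int_\Omega \frac{\varphi(|\nabla u|)}{|\nabla u|}\langle\nabla u,\nabla\psi\rangle\ \ge\ \int_\Omega b\,f(u)\,l(|\nabla u|)\,\psi ,$$ where the integrals are with respect to the Riemannian measure and $\frac{\varphi(|\nabla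 u|)}{|\nabla u|}\nabla u:=0$ where $\nabla u=0$. Consider the following properties. * $(\mathrm{WMP}_\infty)$, the weak maximum principle at infinity for $(bl)^{-1}\Delta_\varphi$: for each non-constant $u\in\mathrm{Lip}_{\rm loc}(M)$ with $u^*=\sup_M u<\infty$, each $\eta<u^*$ and each $K\in\mathbb R$, if $\Delta_\varphi u\ge K\,b(x)\,l(|\nabla u|)$ weakly on $\{x\in M: u(x)>\eta\}$, then $K\le 0$. * $(\mathrm{L})$ for $f$, the Liouville property: there are no non-negative, non-constant, bounded $\mathrm{Lip}_{\rm loc}$ solutions of $(P_\ge)$ on $M$. * $(\mathrm{S})$ for $f$: each non-constant $\mathrm{Lip}_{\rm loc}$ solution $u$ of $(P_\ge)$ on $M$ that is bounded above satisfies $f(u^*)\le 0$, where $u^*=\sup_M u$. * $(\mathrm{OWMP}_\infty)$, the open weak maximum principle at infinity for $(bl)^{-1}\Delta_\varphi$: for each $f\in C(\mathbb R)$, each open set $\Omega\subset M$ with $\partial\Omega\ne\emptyset$ and each $u\in C(\overline\Omega)\cap\mathrm{Lip}_{\rm loc}(\Omega)$ that solves $(P_\ge)$ on $\Omega$ and satisfies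 $\sup_\Omega u<\infty$, either $\sup_\Omega u=\sup_{\partial\Omega}u$ or $f(\sup_\Omega u)\le 0$. Then, for fixed $\varphi$, $b$, $l$ as above, the following are equivalent: 1. $(bl)^{-1}\Delta_\varphi$ satisfies $(\mathrm{WMP}_\infty)$; 2. $(\mathrm{L})$ holds for some $f\in C(\mathbb R)$ with $f(0)=0$ and $f>0$ on $\mathbb R^+$; 3. $(\mathrm{L})$ holds for every $f\in C(\mathbb R)$ with $f(0)=0$ and $f>0$ on $\mathbb R^+$; 4. $(\mathrm{S})$ holds for some $f\in C(\mathbb R)$ with $f(0)=0$ and $f>0$ on $\mathbb R^+$; 5. $(\mathrm{S})$ holds for every $f\in C(\mathbb R)$; 6. $(bl)^{-1}\Delta_\varphi$ satisfies $(\mathrm{OWMP}_\infty)$. -/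

import Mathlib

open scoped Manifold ContDiff Topology Bundle
open MeasureTheory Set Bundle

noncomputable section

namespace PhiLaplace

section Riemannian

variable {m : ℕ} {M : Type*} [EMetricSpace M] [ChartedSpace (EuclideanSpace ℝ (Fin m)) M]
  [IsManifold (𝓡 m) ∞ M] [RiemannianBundle (fun x : M => TangentSpace (𝓡 m) x)]

instance instFiniteDimensionalTangentSpace (x : M) :
    FiniteDimensional ℝ (TangentSpace (𝓡 m) x) :=
  inferInstanceAs (FiniteDimensional ℝ (EuclideanSpace ℝ (Fin m)))

instance instCompleteSpaceTangentSpace (x : M) : CompleteSpace (TangentSpace (𝓡 m) x) :=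
  FiniteDimensional.complete ℝ _

/-- The Riemannian gradient of `u` at `x`: the vector representing the differential of `u` at `x`
through the Riemannian inner product. (It is `0` where `u` is not differentiable; a locally
Lipschitz function is differentiable almost everywhere.) -/
def grad (u : M → ℝ) (x : M) : TangentSpace (𝓡 m) x :=
  (InnerProductSpace.toDual ℝ (TangentSpace (𝓡 m) x)).symm
    (mfderiv (𝓡 m) 𝓘(ℝ, ℝ) u x : TangentSpace (𝓡 m) x →L[ℝ] ℝ)

/-- The `i`-th coordinate vector field of the preferred chart at `x₀`, at the point of `M` with
coordinates `y`. -/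
def coordVec (x₀ : M) (y : EuclideanSpace ℝ (Fin m)) (i : Fin m) :
    TangentSpace (𝓡 m) ((chartAt (EuclideanSpace ℝ (Fin m)) x₀).symm y) :=
  mfderiv (𝓡 m) (𝓡 m) (chartAt (EuclideanSpace ℝ (Fin m)) x₀).symm y
    (EuclideanSpace.single i (1 : ℝ) : EuclideanSpace ℝ (Fin m))

/-- The density `√(det (g_ij))` of the metric in the preferred chart at `x₀`. -/
def volumeDensity (x₀ : M) (y : EuclideanSpace ℝ (Fin m)) : ℝ :=
  Real.sqrt (Matrix.gram ℝ (coordVec x₀ y)).det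

variable [MeasurableSpace M]

/-- The Riemannian measure on the domain of the preferred chart at `x₀`: the image under the
inverse chart of `√(det (g_ij)) dy` on the range of the chart. -/
def chartMeasure (x₀ : M) : Measure M :=
  ((volume.restrict (chartAt (EuclideanSpace ℝ (Fin m)) x₀).target).withDensity
    (fun y => ENNReal.ofReal (volumeDensity x₀ y))).map
      (chartAt (EuclideanSpace ℝ (Fin m)) x₀).symm

variable (m M) in
/-- The Riemannian measure. The measures in the various charts agree on overlaps, and the
Riemannian measure is obtained by gluing them: it is the least measure that dominates all of
them. -/
def riemannianMeasure : Measure M := ⨆ x₀ : M, chartMeasure (m := m) x₀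

/-- `u` is a `Lip_loc` solution of `Δ_φ u ≥ b(x) f(u) l(|∇u|)` on the open set `Ω`: it is locally
Lipschitz on `Ω`, and it satisfies the inequality weakly, against all nonnegative
`ψ ∈ C^∞_c(Ω)`. The values of `u` outside `Ω` play no role. At points where `∇u = 0` the field
`φ(|∇u|) |∇u|⁻¹ ∇u` is `0`. -/
def IsSubsolution (φ : ℝ → ℝ) (b : M → ℝ) (f l : ℝ → ℝ) (Ω : Set M) (u : M → ℝ) : Prop :=
  LocallyLipschitzOn Ω u ∧
  ∀ ψ : M → ℝ, ContMDiff (𝓡 m) 𝓘(ℝ, ℝ) ∞ ψ → HasCompactSupport ψ → tsupport ψ ⊆ Ω →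
    (∀ x, 0 ≤ ψ x) →
    ∫ x in Ω, b x * f (u x) * l ‖grad (m := m) u x‖ * ψ x ∂(riemannianMeasure m M) ≤
      - ∫ x in Ω, φ ‖grad (m := m) u x‖ / ‖grad (m := m) u x‖ *
          inner ℝ (grad (m := m) u x) (grad (m := m) ψ x) ∂(riemannianMeasure m M)

/-- `u` is non-constant on `M`. -/
def NonConstant (u : M → ℝ) : Prop := ¬ ∃ c : ℝ, ∀ x, u x = c

variable (m) in
/-- The weak maximum principle at infinity for `(b l)⁻¹ Δ_φ`. -/
def WMP (φ : ℝ → ℝ) (b : M → ℝ) (l : ℝ → ℝ) : Prop :=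
  ∀ u : M → ℝ, LocallyLipschitz u → NonConstant u → BddAbove (range u) →
    ∀ η : ℝ, η < ⨆ x, u x → ∀ K : ℝ,
      IsSubsolution (m := m) φ b (fun _ => K) l {x | η < u x} u → K ≤ 0

variable (m) in
/-- The Liouville property for `Δ_φ u ≥ b(x) f(u) l(|∇u|)` on `M`: there are no nonnegative,
non-constant, bounded `Lip_loc` solutions on all of `M`. -/
def Liouville (φ : ℝ → ℝ) (b : M → ℝ) (f l : ℝ → ℝ) : Prop :=
  ¬ ∃ u : M → ℝ, IsSubsolution (m := m) φ b f l univ u ∧ (∀ x, 0 ≤ u x) ∧ NonConstant u ∧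
    ∃ C : ℝ, ∀ x, |u x| ≤ C

variable (m) in
/-- Each non-constant, bounded above `Lip_loc` solution `u` of `Δ_φ u ≥ b(x) f(u) l(|∇u|)` on `M`
satisfies `f(sup u) ≤ 0`. -/
def SupEstimate (φ : ℝ → ℝ) (b : M → ℝ) (f l : ℝ → ℝ) : Prop :=
  ∀ u : M → ℝ, IsSubsolution (m := m) φ b f l univ u → NonConstant u → BddAbove (range u) →
    f (⨆ x, u x) ≤ 0

variable (m) in
/-- The open weak maximum principle at infinity for `(b l)⁻¹ Δ_φ`. -/
def OWMP (φ : ℝ → ℝ) (b : M → ℝ) (l : ℝ → ℝ) : Prop :=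
  ∀ f : ℝ → ℝ, Continuous f → ∀ Ω : Set M, IsOpen Ω → (frontier Ω).Nonempty →
    ∀ u : M → ℝ, ContinuousOn u (closure Ω) → IsSubsolution (m := m) φ b f l Ω u →
      BddAbove (u '' Ω) →
      sSup (u '' Ω) = sSup (u '' frontier Ω) ∨ f (sSup (u '' Ω)) ≤ 0

/-- `f ∈ C(ℝ)` with `f(0) = 0` and `f > 0` on `(0, ∞)`. -/
structure IsAdmissible (f : ℝ → ℝ) : Prop where
  continuous : Continuous f
  zero : f 0 = 0
  pos : ∀ t, 0 < t → 0 < f t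

end Riemannian

end PhiLaplace

end

/-! The implications divide into soft ones and one analytic one.

Soft part. Suppose `f(u*) > 0`. By continuity `f(u) ≥ f(u*)/2 > 0` wherever `u` is close to `u*`, so
on a high superlevel set `u` solves the inequality with constant right-hand side `K = f(u*)/2`,
which the weak maximum principle excludes (`WMP.supEstimate`). Gluing a solution on `Ω` to a
constant above its boundary supremum gives the open version (`WMP.owmp`). Conversely, a superlevel
set is an admissible `Ω`, with nonempty frontier by connectedness (`OWMP.wmp`). The supremum
estimate gives the Liouville property because a nonnegative non-constant `u` has `u* > 0`.

Analytic part (`Liouville.wmp`). If the weak maximum principle fails with some `K > 0`, raise `η`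
towards `u*` until `f ≤ K` on the values of `(u - η)⁺`. Then `(u - η)⁺` should be a global solution
for `f`, contradicting Liouville. This is a Kato-type statement (`IsSubsolution.max_sub`): the
inequality on `{η < u}` must be tested with functions `ψ` not supported there. One tests with
`χ(u)ψ`, where `χ` is a nondecreasing cutoff vanishing up to some level above `η`. The extra term `ψ
χ'(u) φ(|∇u|)|∇u|` is nonnegative and can be dropped, after which `χ` increases to the indicator of
`(η, ∞)`.

Since `χ(u)ψ` is only Lipschitz and test functions must be smooth, `u` is replaced inside the test
function by mollifications `w n` in a chart, converging uniformly with bounded gradients that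
converge almost everywhere (`exists_isSmoothing`). The field `φ(|∇u|)|∇u|⁻¹∇u` is never regularized,
so the limit is linear in the approximated gradient and no structure of `φ` beyond continuity and
sign enters. A partition of unity makes the result global. -/

noncomputable section

set_option linter.unusedSectionVars false

namespace PhiLaplace

/-! ### Differentials in charts -/

section Chart

variable {m : ℕ} {M : Type*} [TopologicalSpace M] [ChartedSpace (EuclideanSpace ℝ (Fin m)) M]
  [IsManifold (𝓡 m) ∞ M]

/-- The differential at `y` of the preferred chart at `x₀`. -/
def chartDeriv (x₀ y : M) : TangentSpace (𝓡 m) y →L[ℝ] EuclideanSpace ℝ (Fin m) :=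
  (trivializationAt (EuclideanSpace ℝ (Fin m)) (TangentSpace (𝓡 m)) x₀).continuousLinearMapAt ℝ y

/-- The differential, with values in the tangent space at `y`, of the inverse of the preferred
chart at `x₀`. -/
def chartSymmDeriv (x₀ y : M) : EuclideanSpace ℝ (Fin m) →L[ℝ] TangentSpace (𝓡 m) y :=
  (trivializationAt (EuclideanSpace ℝ (Fin m)) (TangentSpace (𝓡 m)) x₀).symmL ℝ y

lemma chartSymmDeriv_chartDeriv {x₀ y : M}
    (hy : y ∈ (chartAt (EuclideanSpace ℝ (Fin m)) x₀).source) (v : TangentSpace (𝓡 m) y) :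
    chartSymmDeriv x₀ y (chartDeriv x₀ y v) = v :=
  (trivializationAt (EuclideanSpace ℝ (Fin m)) (TangentSpace (𝓡 m)) x₀).symmL_continuousLinearMapAt
    (by simpa using hy) v

lemma chartDeriv_chartSymmDeriv {x₀ y : M}
    (hy : y ∈ (chartAt (EuclideanSpace ℝ (Fin m)) x₀).source) (v : EuclideanSpace ℝ (Fin m)) :
    chartDeriv x₀ y (chartSymmDeriv x₀ y v) = v :=
  (trivializationAt (EuclideanSpace ℝ (Fin m)) (TangentSpace (𝓡 m)) x₀).continuousLinearMapAt_symmL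
    (by simpa using hy) v

lemma hasMFDerivAt_chartAt {x₀ y : M}
    (hy : y ∈ (chartAt (EuclideanSpace ℝ (Fin m)) x₀).source) :
    HasMFDerivAt (𝓡 m) 𝓘(ℝ, EuclideanSpace ℝ (Fin m)) (chartAt (EuclideanSpace ℝ (Fin m)) x₀) y
      (chartDeriv x₀ y) := by
  have h1 := (mdifferentiableAt_extChartAt (I := 𝓡 m) hy).hasMFDerivAt
  rw [← TangentBundle.continuousLinearMapAt_trivializationAt hy] at h1
  exact h1

lemma hasMFDerivAt_chartAt_symm {x₀ y : M}
    (hy : y ∈ (chartAt (EuclideanSpace ℝ (Fin m)) x₀).source) :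
    HasMFDerivAt (𝓡 m) (𝓡 m) (chartAt (EuclideanSpace ℝ (Fin m)) x₀).symm
      (chartAt (EuclideanSpace ℝ (Fin m)) x₀ y) (chartSymmDeriv x₀ y) := by
  have h1 := (mdifferentiableWithinAt_extChartAt_symm (I := 𝓡 m) (x := x₀)
    (z := extChartAt (𝓡 m) x₀ y) ((extChartAt (𝓡 m) x₀).map_source (by simpa using hy))).hasMFDerivWithinAt
  rw [← TangentBundle.symmL_trivializationAt hy] at h1
  have h2 : range (𝓡 m) = univ := by simp
  rw [h2] at h1
  exact HasMFDerivWithinAt.hasMFDerivAt h1 Filter.univ_mem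

lemma mfderiv_chartAt_symm {x₀ : M} {z : EuclideanSpace ℝ (Fin m)}
    (hz : z ∈ (chartAt (EuclideanSpace ℝ (Fin m)) x₀).target) (v : EuclideanSpace ℝ (Fin m)) :
    mfderiv (𝓡 m) (𝓡 m) (chartAt (EuclideanSpace ℝ (Fin m)) x₀).symm z v =
      chartSymmDeriv x₀ ((chartAt (EuclideanSpace ℝ (Fin m)) x₀).symm z) v := by
  set χ := chartAt (EuclideanSpace ℝ (Fin m)) x₀
  have h := (hasMFDerivAt_chartAt_symm (χ.map_target hz)).mfderiv
  -- The types of the two derivatives depend on the base point; viewing both as maps of the model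
  -- space permits the substitution.
  have h2 : ∀ w, w = z → (mfderiv (𝓡 m) (𝓡 m) χ.symm w :
     EuclideanSpace ℝ (Fin m) →L[ℝ] EuclideanSpace ℝ (Fin m)) = mfderiv (𝓡 m) (𝓡 m) χ.symm z := by
    rintro w rfl; rfl
  have h4 := (h2 _ (χ.right_inv hz)).symm.trans h
  exact congrArg (fun L : EuclideanSpace ℝ (Fin m) →L[ℝ] EuclideanSpace ℝ (Fin m) => L v) h4

/-- The differential of a real function, as a real-valued linear form. -/
def differential (f : M → ℝ) (y : M) : TangentSpace (𝓡 m) y →L[ℝ] ℝ :=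
  mfderiv (𝓡 m) 𝓘(ℝ, ℝ) f y

/-- The differential of a function in terms of its expression in a chart. -/
lemma differential_eq_fderiv (f : M → ℝ) {x₀ y : M}
    (hy : y ∈ (chartAt (EuclideanSpace ℝ (Fin m)) x₀).source) :
    differential f y = (fderiv ℝ (f ∘ (chartAt (EuclideanSpace ℝ (Fin m)) x₀).symm)
        (chartAt (EuclideanSpace ℝ (Fin m)) x₀ y)).comp (chartDeriv x₀ y) := by
  set χ := chartAt (EuclideanSpace ℝ (Fin m)) x₀
  by_cases hf : DifferentiableAt ℝ (f ∘ χ.symm) (χ y)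
  · have h1 := HasMFDerivAt.comp y hf.hasFDerivAt.hasMFDerivAt (hasMFDerivAt_chartAt hy)
    have h2 := h1.congr_of_eventuallyEq (f₁ := f) (by
      filter_upwards [χ.open_source.mem_nhds hy] with z hz
      simp [χ.left_inv hz, χ])
    exact h2.mfderiv
  -- Nondifferentiability is the same on `M` and in the chart, so both derivatives take the default
  -- value `0`.
  · rw [fderiv_zero_of_not_differentiableAt hf]
    have h1 : ¬ MDifferentiableAt (𝓡 m) 𝓘(ℝ, ℝ) f y := by
      intro h
      have h1 : MDifferentiableAt (𝓡 m) 𝓘(ℝ, ℝ) f (χ.symm (χ y)) := by rwa [χ.left_inv hy]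
      exact hf (h1.comp (χ y) (hasMFDerivAt_chartAt_symm hy).mdifferentiableAt).differentiableAt
    rw [differential, mfderiv_zero_of_not_mdifferentiableAt h1]
    rfl

end Chart

/-- If `A` is the matrix of `J` and `G` the Gram matrix of the images of the basis under `S`, the
new Gram matrix is `AᵀGA`. After a square root, `|det J|` is the Jacobian factor of a change of
charts. -/
lemma det_gram_comp {m : ℕ} {V : Type*} [NormedAddCommGroup V] [InnerProductSpace ℝ V]
    (S : EuclideanSpace ℝ (Fin m) →ₗ[ℝ] V)
    (J : EuclideanSpace ℝ (Fin m) →ₗ[ℝ] EuclideanSpace ℝ (Fin m)) :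
    (Matrix.gram ℝ fun i => S (J (EuclideanSpace.single i (1 : ℝ)))).det =
      LinearMap.det J ^ 2 * (Matrix.gram ℝ fun i => S (EuclideanSpace.single i (1 : ℝ))).det := by
  set A := LinearMap.toMatrix (EuclideanSpace.basisFun (Fin m) ℝ).toBasis
    (EuclideanSpace.basisFun (Fin m) ℝ).toBasis J with hA
  have hJ : LinearMap.det J = A.det := (LinearMap.det_toMatrix _ J).symm
  have hcol : ∀ i, J (EuclideanSpace.single i (1 : ℝ)) =
      ∑ k, A k i • EuclideanSpace.single k (1 : ℝ) := by
    intro i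
    have := (EuclideanSpace.basisFun (Fin m) ℝ).toBasis.sum_repr (J (EuclideanSpace.single i 1))
    simp only [OrthonormalBasis.coe_toBasis, EuclideanSpace.basisFun_apply] at this
    rw [← this]
    simp [hA, LinearMap.toMatrix_apply]
  have hG : (Matrix.gram ℝ fun i => S (J (EuclideanSpace.single i (1 : ℝ)))) =
      A.transpose * (Matrix.gram ℝ fun i => S (EuclideanSpace.single i (1 : ℝ))) * A := by
    ext i j
    simp only [Matrix.gram_apply, hcol, map_sum, map_smul, sum_inner, inner_sum, inner_smul_left,
      inner_smul_right, Matrix.mul_apply, Matrix.transpose_apply, Finset.sum_mul, Finset.mul_sum]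
    refine Finset.sum_congr rfl fun p _ => Finset.sum_congr rfl fun q _ => ?_
    simp only [RCLike.conj_to_real]
    ring
  rw [hG, Matrix.det_mul, Matrix.det_mul, Matrix.det_transpose, hJ]
  ring

/-! ### The Riemannian measure in charts -/

section Measure

variable {m : ℕ} {M : Type*} [EMetricSpace M] [ChartedSpace (EuclideanSpace ℝ (Fin m)) M]
  [IsManifold (𝓡 m) ∞ M] [RiemannianBundle (fun x : M => TangentSpace (𝓡 m) x)]

lemma coordVec_eq {x₀ : M} {z : EuclideanSpace ℝ (Fin m)}
    (hz : z ∈ (chartAt (EuclideanSpace ℝ (Fin m)) x₀).target) (i : Fin m) :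
    coordVec x₀ z i = chartSymmDeriv x₀ ((chartAt (EuclideanSpace ℝ (Fin m)) x₀).symm z)
      (EuclideanSpace.single i (1 : ℝ)) :=
  mfderiv_chartAt_symm hz _

lemma volumeDensity_eq {x₀ : M} {z : EuclideanSpace ℝ (Fin m)}
    (hz : z ∈ (chartAt (EuclideanSpace ℝ (Fin m)) x₀).target) :
    volumeDensity x₀ z = Real.sqrt (Matrix.gram ℝ fun i : Fin m =>
      chartSymmDeriv x₀ ((chartAt (EuclideanSpace ℝ (Fin m)) x₀).symm z)
        (EuclideanSpace.single i (1 : ℝ))).det := by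
  rw [volumeDensity]
  congr 3
  ext i
  rw [coordVec_eq hz]

/-- The differential of a change of charts. -/
def transitionDeriv (x₀ x₁ y : M) : EuclideanSpace ℝ (Fin m) →L[ℝ] EuclideanSpace ℝ (Fin m) :=
  (chartDeriv x₀ y).comp (chartSymmDeriv x₁ y)

lemma hasFDerivAt_transition {x₀ x₁ y : M}
    (h₀ : y ∈ (chartAt (EuclideanSpace ℝ (Fin m)) x₀).source)
    (h₁ : y ∈ (chartAt (EuclideanSpace ℝ (Fin m)) x₁).source) :
    HasFDerivAt (chartAt (EuclideanSpace ℝ (Fin m)) x₀ ∘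
      (chartAt (EuclideanSpace ℝ (Fin m)) x₁).symm) (transitionDeriv x₀ x₁ y)
      (chartAt (EuclideanSpace ℝ (Fin m)) x₁ y) := by
  have h := hasMFDerivAt_chartAt h₀
  have h2 : HasMFDerivAt (𝓡 m) 𝓘(ℝ, EuclideanSpace ℝ (Fin m))
      (chartAt (EuclideanSpace ℝ (Fin m)) x₀) ((chartAt (EuclideanSpace ℝ (Fin m)) x₁).symm
        (chartAt (EuclideanSpace ℝ (Fin m)) x₁ y)) (chartDeriv x₀ y) := by
    rwa [(chartAt (EuclideanSpace ℝ (Fin m)) x₁).left_inv h₁]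
  exact (h2.comp _ (hasMFDerivAt_chartAt_symm h₁)).hasFDerivAt

lemma volumeDensity_transition {x₀ x₁ y : M}
    (h₀ : y ∈ (chartAt (EuclideanSpace ℝ (Fin m)) x₀).source)
    (h₁ : y ∈ (chartAt (EuclideanSpace ℝ (Fin m)) x₁).source) :
    volumeDensity x₁ (chartAt (EuclideanSpace ℝ (Fin m)) x₁ y) =
      |(transitionDeriv (m := m) x₀ x₁ y).det| *
        volumeDensity x₀ (chartAt (EuclideanSpace ℝ (Fin m)) x₀ y) := by
  have key : ∀ (x : M), y ∈ (chartAt (EuclideanSpace ℝ (Fin m)) x).source →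
      volumeDensity x (chartAt (EuclideanSpace ℝ (Fin m)) x y) =
      Real.sqrt (Matrix.gram ℝ fun i : Fin m =>
        chartSymmDeriv x y (EuclideanSpace.single i (1 : ℝ))).det := by
    intro x hx
    rw [volumeDensity_eq ((chartAt (EuclideanSpace ℝ (Fin m)) x).map_source hx),
      (chartAt (EuclideanSpace ℝ (Fin m)) x).left_inv hx]
  rw [key x₁ h₁, key x₀ h₀]
  have h2 := det_gram_comp (V := TangentSpace (𝓡 m) y) (chartSymmDeriv x₀ y).toLinearMap
    (transitionDeriv x₀ x₁ y).toLinearMap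
  have h3 : ∀ v, chartSymmDeriv x₀ y (transitionDeriv x₀ x₁ y v) = chartSymmDeriv x₁ y v :=
    fun v => chartSymmDeriv_chartDeriv h₀ _
  simp only [ContinuousLinearMap.coe_coe, h3] at h2
  rw [h2, Real.sqrt_mul (sq_nonneg _), Real.sqrt_sq_eq_abs]

variable [MeasurableSpace M] [BorelSpace M]

lemma measurableSet_target_inter_preimage (x₀ : M) {A : Set M} (hA : MeasurableSet A) :
    MeasurableSet ((chartAt (EuclideanSpace ℝ (Fin m)) x₀).target ∩
      (chartAt (EuclideanSpace ℝ (Fin m)) x₀).symm ⁻¹' A) := by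
  set χ := chartAt (EuclideanSpace ℝ (Fin m)) x₀
  have h : Measurable (χ.target.domRestrict χ.symm) :=
    (continuousOn_iff_continuous_domRestrict.1 χ.continuousOn_symm).measurable
  have h2 := (MeasurableEmbedding.subtype_coe χ.open_target.measurableSet).measurableSet_image.2
    (h hA)
  convert h2
  ext z
  simp [domRestrict, and_comm]

lemma chartMeasure_apply (x₀ : M) {A : Set M} (hA : MeasurableSet A) :
    chartMeasure (m := m) x₀ A = ∫⁻ z in (chartAt (EuclideanSpace ℝ (Fin m)) x₀).target ∩
      (chartAt (EuclideanSpace ℝ (Fin m)) x₀).symm ⁻¹' A,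
        ENNReal.ofReal (volumeDensity x₀ z) := by
  set χ := chartAt (EuclideanSpace ℝ (Fin m)) x₀ with hχ
  have hae : AEMeasurable χ.symm ((volume.restrict χ.target).withDensity
      (fun y => ENNReal.ofReal (volumeDensity x₀ y))) :=
    (χ.continuousOn_symm.aemeasurable χ.open_target.measurableSet).mono_ac
      (withDensity_absolutelyContinuous _ _)
  rw [chartMeasure, Measure.map_apply_of_aemeasurable hae hA, withDensity_apply',
    Measure.restrict_restrict₀', inter_comm]
  exact χ.open_target.measurableSet.nullMeasurableSet

/-- This is the change of variables formula for the transition map. It is only an inequality because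
the chart at `x₁` need not cover `A`. -/
lemma chartMeasure_le (x₀ x₁ : M) {A : Set M} (hA : MeasurableSet A)
    (hA₀ : A ⊆ (chartAt (EuclideanSpace ℝ (Fin m)) x₀).source) :
    chartMeasure (m := m) x₁ A ≤ chartMeasure (m := m) x₀ A := by
  rw [chartMeasure_apply x₀ hA, chartMeasure_apply x₁ hA]
  set χ₀ := chartAt (EuclideanSpace ℝ (Fin m)) x₀ with hχ₀
  set χ₁ := chartAt (EuclideanSpace ℝ (Fin m)) x₁ with hχ₁
  set T := χ₁.target ∩ χ₁.symm ⁻¹' A with hT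
  have hTm : MeasurableSet T := measurableSet_target_inter_preimage x₁ hA
  have hder : ∀ z ∈ T, HasFDerivWithinAt (χ₀ ∘ χ₁.symm) (transitionDeriv x₀ x₁ (χ₁.symm z)) T z := by
    intro z hz
    have := hasFDerivAt_transition (hA₀ hz.2) (χ₁.map_target hz.1)
    rw [χ₁.right_inv hz.1] at this
    exact this.hasFDerivWithinAt
  have hinj : InjOn (χ₀ ∘ χ₁.symm) T := by
    intro a ha b hb hab
    exact χ₁.symm.injOn ha.1 hb.1 (χ₀.injOn (hA₀ ha.2) (hA₀ hb.2) hab)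
  calc ∫⁻ z in T, ENNReal.ofReal (volumeDensity x₁ z)
      = ∫⁻ z in T, ENNReal.ofReal |(transitionDeriv x₀ x₁ (χ₁.symm z)).det| *
          ENNReal.ofReal (volumeDensity x₀ ((χ₀ ∘ χ₁.symm) z)) := by
        refine setLIntegral_congr_fun hTm fun z hz => ?_
        have := volumeDensity_transition (hA₀ hz.2) (χ₁.map_target hz.1)
        rw [χ₁.right_inv hz.1] at this
        simp only [Function.comp]
        rw [this, ENNReal.ofReal_mul (abs_nonneg _)]
    _ = ∫⁻ z in (χ₀ ∘ χ₁.symm) '' T, ENNReal.ofReal (volumeDensity x₀ z) :=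
        (lintegral_image_eq_lintegral_abs_det_fderiv_mul volume hTm hder hinj
          (fun z => ENNReal.ofReal (volumeDensity x₀ z))).symm
    _ ≤ _ := by
        refine lintegral_mono_set ?_
        rintro _ ⟨z, hz, rfl⟩
        refine ⟨χ₀.map_source (hA₀ hz.2), ?_⟩
        simp only [mem_preimage, Function.comp]
        rw [χ₀.left_inv (hA₀ hz.2)]
        exact hz.2

/-- The chart measure restricted to `A` plus the Riemannian measure restricted to `Aᶜ` dominates
every chart measure, hence their supremum; evaluate at `A`. This upper bound suffices for null sets
and local finiteness. -/
lemma riemannianMeasure_le_chartMeasure (x₀ : M) {A : Set M} (hA : MeasurableSet A)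
    (hA₀ : A ⊆ (chartAt (EuclideanSpace ℝ (Fin m)) x₀).source) :
    riemannianMeasure m M A ≤ chartMeasure (m := m) x₀ A := by
  have h : riemannianMeasure m M ≤
      (chartMeasure (m := m) x₀).restrict A + (riemannianMeasure m M).restrict Aᶜ := by
    refine iSup_le fun x₁ => ?_
    rw [← Measure.restrict_add_restrict_compl (μ := chartMeasure (m := m) x₁) hA]
    refine add_le_add ?_ (Measure.restrict_mono_measure ?_ _)
    · refine Measure.le_iff.2 fun B hB => ?_
      rw [Measure.restrict_apply hB, Measure.restrict_apply hB]
      exact chartMeasure_le x₀ x₁ (hB.inter hA) (inter_subset_right.trans hA₀)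
    · exact le_iSup (fun x₀ : M => chartMeasure (m := m) x₀) x₁
  refine (h A).trans ?_
  simp [Measure.restrict_apply hA]

/-- Points of a chart domain whose coordinates lie in a null set form a null set. -/
lemma ae_chart {x₀ : M} {p : EuclideanSpace ℝ (Fin m) → Prop} (hp : ∀ᵐ z, p z) :
    ∀ᵐ x ∂(riemannianMeasure m M), x ∈ (chartAt (EuclideanSpace ℝ (Fin m)) x₀).source →
      p (chartAt (EuclideanSpace ℝ (Fin m)) x₀ x) := by
  set χ := chartAt (EuclideanSpace ℝ (Fin m)) x₀ with hχ
  obtain ⟨N, hN, hNm, hN0⟩ := exists_measurable_superset_of_null (ae_iff.1 hp)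
  have hA : MeasurableSet (χ.source ∩ χ ⁻¹' N) := by
    have h : Measurable (χ.source.domRestrict χ) :=
      (continuousOn_iff_continuous_domRestrict.1 χ.continuousOn).measurable
    have h2 := (MeasurableEmbedding.subtype_coe χ.open_source.measurableSet).measurableSet_image.2
      (h hNm)
    convert h2
    ext z
    simp [domRestrict, and_comm]
  have h0 : riemannianMeasure m M (χ.source ∩ χ ⁻¹' N) = 0 := by
    refine le_antisymm ((riemannianMeasure_le_chartMeasure x₀ hA inter_subset_left).trans ?_) bot_le
    rw [chartMeasure_apply x₀ hA]
    refine le_of_eq (setLIntegral_measure_zero _ _ (measure_mono_null ?_ hN0))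
    rintro z ⟨hz, -, hz2⟩
    rwa [mem_preimage, ← hχ, χ.right_inv hz] at hz2
  refine measure_mono_null ?_ h0
  intro x hx
  simp only [mem_compl_iff, mem_ofPred_eq, not_forall] at hx
  exact ⟨hx.1, hN hx.2⟩

end Measure

/-! ### Consequences of the continuity of the metric -/

section Metric

variable {m : ℕ} {M : Type*} [EMetricSpace M] [ChartedSpace (EuclideanSpace ℝ (Fin m)) M]
  [IsManifold (𝓡 m) ∞ M] [RiemannianBundle (fun x : M => TangentSpace (𝓡 m) x)]
  [IsContinuousRiemannianBundle (EuclideanSpace ℝ (Fin m))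
      (fun x : M => TangentSpace (𝓡 m) x)]

lemma eventually_norm_chartDeriv_lt (x₀ : M) :
    ∃ C > 0, ∀ᶠ y in 𝓝 x₀, ‖chartDeriv (m := m) x₀ y‖ < C :=
  eventually_norm_trivializationAt_lt (EuclideanSpace ℝ (Fin m))
    (fun x : M => TangentSpace (𝓡 m) x) x₀

lemma eventually_norm_chartSymmDeriv_lt (x₀ : M) :
    ∃ C > 0, ∀ᶠ y in 𝓝 x₀, ‖chartSymmDeriv (m := m) x₀ y‖ < C :=
  eventually_norm_symmL_trivializationAt_lt (EuclideanSpace ℝ (Fin m))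
    (fun x : M => TangentSpace (𝓡 m) x) x₀

/-- A ball in coordinates on which the inverse chart has bounded differential. -/
lemma exists_ball_norm_chartSymmDeriv_le (x₀ : M) :
    ∃ C > (0 : ℝ), ∃ r > 0, ∀ z ∈ Metric.ball (chartAt (EuclideanSpace ℝ (Fin m)) x₀ x₀) r,
      z ∈ (chartAt (EuclideanSpace ℝ (Fin m)) x₀).target ∧
      ‖chartSymmDeriv (m := m) x₀ ((chartAt (EuclideanSpace ℝ (Fin m)) x₀).symm z)‖ ≤ C := by
  obtain ⟨C, hC, h⟩ := eventually_norm_chartSymmDeriv_lt (m := m) x₀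
  refine ⟨C, hC, ?_⟩
  set χ := chartAt (EuclideanSpace ℝ (Fin m)) x₀ with hχ
  have hx : x₀ ∈ χ.source := mem_chart_source _ x₀
  have h1 : ∀ᶠ z in 𝓝 (χ x₀), z ∈ χ.target := χ.open_target.mem_nhds (χ.map_source hx)
  have h2 : ∀ᶠ z in 𝓝 (χ x₀), ‖chartSymmDeriv (m := m) x₀ (χ.symm z)‖ < C := by
    have h3 := χ.continuousAt_symm (χ.map_source hx)
    rw [ContinuousAt, χ.left_inv hx] at h3
    exact h3.eventually h
  obtain ⟨r, hr, h4⟩ := Metric.eventually_nhds_iff_ball.1 (h1.and h2)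
  exact ⟨r, hr, fun z hz => ⟨(h4 z hz).1, (h4 z hz).2.le⟩⟩

/-- The inverse of a chart is Lipschitz near the base point. -/
lemma exists_lipschitzOnWith_chartAt_symm [IsRiemannianManifold (𝓡 m) M] (x₀ : M) :
    ∃ C : NNReal, ∃ r > 0,
      Metric.ball (chartAt (EuclideanSpace ℝ (Fin m)) x₀ x₀) r ⊆
        (chartAt (EuclideanSpace ℝ (Fin m)) x₀).target ∧
      LipschitzOnWith C (chartAt (EuclideanSpace ℝ (Fin m)) x₀).symm
        (Metric.ball (chartAt (EuclideanSpace ℝ (Fin m)) x₀ x₀) r) := by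
  obtain ⟨C, hC, r, hr, h⟩ := exists_ball_norm_chartSymmDeriv_le (m := m) x₀
  refine ⟨C.toNNReal, r, hr, fun z hz => (h z hz).1, ?_⟩
  set χ := chartAt (EuclideanSpace ℝ (Fin m)) x₀ with hχ
  intro y hy z hz
  rw [IsRiemannianManifold.out (I := 𝓡 m)]
  -- The image of a coordinate segment is a curve of length at most `C * ‖z - y‖`, which bounds the
  -- Riemannian distance of its endpoints.
  let η : ℝ → EuclideanSpace ℝ (Fin m) := AffineMap.lineMap y z
  have hη : ∀ t ∈ Icc (0 : ℝ) 1, η t ∈ Metric.ball (χ x₀) r := fun t ht =>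
    (convex_ball (χ x₀) r).lineMap_mem hy hz ht
  have hsm : ContMDiff 𝓘(ℝ, ℝ) (𝓡 m) 1 η := by
    rw [contMDiff_iff_contDiff]
    exact (ContinuousAffineMap.lineMap (R := ℝ) y z).contDiff
  have hder : ∀ t, HasFDerivAt η (ContinuousLinearMap.smulRight (1 : ℝ →L[ℝ] ℝ) (z - y)) t :=
    fun t => (AffineMap.hasDerivAt_lineMap (a := y) (b := z) (x := t)).hasFDerivAt
  refine (Manifold.riemannianEDist_le_pathELength (γ := χ.symm ∘ η) (a := 0) (b := 1)
    ?_ (by simp [η]) (by simp [η]) zero_le_one).trans ?_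
  · exact ((contMDiffOn_chart_symm (I := 𝓡 m) (n := ∞) (x := x₀)).of_le (by simp)).comp hsm.contMDiffOn
      fun t ht => (h _ (hη t ht)).1
  · rw [Manifold.pathELength_eq_lintegral_mfderivWithin_Icc]
    calc _ ≤ ∫⁻ t in Icc (0 : ℝ) 1, (C.toNNReal : ENNReal) * edist y z := by
          refine setLIntegral_mono' measurableSet_Icc fun t ht => ?_
          have hd : HasMFDerivAt 𝓘(ℝ, ℝ) (𝓡 m) (χ.symm ∘ η) t
              ((mfderiv (𝓡 m) (𝓡 m) χ.symm (η t)).comp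
                (ContinuousLinearMap.smulRight (1 : ℝ →L[ℝ] ℝ) (z - y))) :=
            HasMFDerivAt.comp t ((mdifferentiableAt_atlas_symm (I := 𝓡 m)
              (chart_mem_atlas _ x₀) (h _ (hη t ht)).1).hasMFDerivAt) (hder t).hasMFDerivAt
          rw [hd.hasMFDerivWithinAt.mfderivWithin
            (uniqueMDiffWithinAt_iff_uniqueDiffWithinAt.2 (uniqueDiffOn_Icc zero_lt_one t ht))]
          have h1 : ((mfderiv (𝓡 m) (𝓡 m) χ.symm (η t)).comp
                (ContinuousLinearMap.smulRight (1 : ℝ →L[ℝ] ℝ) (z - y))) (1 : ℝ) =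
              chartSymmDeriv x₀ (χ.symm (η t)) (z - y) := by
            rw [← mfderiv_chartAt_symm (h _ (hη t ht)).1]
            change mfderiv (𝓡 m) (𝓡 m) χ.symm (η t) ((1 : ℝ) • (z - y)) = _
            rw [one_smul]
          have h2 : ‖chartSymmDeriv x₀ (χ.symm (η t)) (z - y)‖ ≤ C * ‖z - y‖ :=
            (ContinuousLinearMap.le_opNorm _ _).trans (by gcongr; exact (h _ (hη t ht)).2)
          have h3 : ‖chartSymmDeriv x₀ (χ.symm (η t)) (z - y)‖ₑ ≤ C.toNNReal * edist y z := by
            rw [edist_comm, edist_eq_enorm_sub, ← ofReal_norm, ← ofReal_norm]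
            refine (ENNReal.ofReal_le_ofReal h2).trans ?_
            rw [ENNReal.ofReal_mul hC.le]
            rfl
          exact (congrArg (fun v : TangentSpace (𝓡 m) (χ.symm (η t)) => ‖v‖ₑ) h1).le.trans h3
      _ = _ := by simp

variable [MeasurableSpace M] [BorelSpace M]

lemma exists_nhds_riemannianMeasure_lt_top (x₀ : M) :
    ∃ V ∈ 𝓝 x₀, riemannianMeasure m M V < ⊤ := by
  obtain ⟨C, hC, r, hr, h⟩ := exists_ball_norm_chartSymmDeriv_le (m := m) x₀
  set χ := chartAt (EuclideanSpace ℝ (Fin m)) x₀ with hχ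
  have hx : x₀ ∈ χ.source := mem_chart_source _ x₀
  have ho : IsOpen (χ.source ∩ χ ⁻¹' Metric.ball (χ x₀) r) :=
    χ.isOpen_inter_preimage Metric.isOpen_ball
  refine ⟨_, ho.mem_nhds ⟨hx, Metric.mem_ball_self hr⟩, ?_⟩
  refine (riemannianMeasure_le_chartMeasure x₀ ho.measurableSet inter_subset_left).trans_lt ?_
  rw [chartMeasure_apply x₀ ho.measurableSet, ← hχ]
  -- Bound for the density: the Gram entries are at most `C * C`, and the determinant is a sum of
  -- `m!` products of `m` entries.
  set D := Real.sqrt (Nat.factorial (Fintype.card (Fin m)) • (C * C) ^ Fintype.card (Fin m))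
  have hsub : χ.target ∩ χ.symm ⁻¹' (χ.source ∩ χ ⁻¹' Metric.ball (χ x₀) r) ⊆
      Metric.ball (χ x₀) r := by
    rintro z ⟨hz, -, hz2⟩
    rwa [mem_preimage, χ.right_inv hz] at hz2
  calc _ ≤ ∫⁻ z in Metric.ball (χ x₀) r, ENNReal.ofReal (volumeDensity x₀ z) :=
        lintegral_mono_set hsub
    _ ≤ ∫⁻ z in Metric.ball (χ x₀) r, ENNReal.ofReal D := by
        refine setLIntegral_mono' measurableSet_ball fun z hz => ENNReal.ofReal_le_ofReal ?_
        rw [volumeDensity_eq (h z hz).1]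
        refine Real.sqrt_le_sqrt ((le_abs_self _).trans ?_)
        refine Matrix.det_le (abv := AbsoluteValue.abs) fun i j => ?_
        rw [Matrix.gram_apply]
        refine (abs_real_inner_le_norm _ _).trans ?_
        have : ∀ i : Fin m, ‖chartSymmDeriv x₀ (χ.symm z) (EuclideanSpace.single i (1 : ℝ))‖ ≤ C := by
          intro i
          refine (ContinuousLinearMap.le_opNorm _ _).trans ?_
          simpa using (h z hz).2
        gcongr <;> exact this _
    _ < ⊤ := by
        rw [setLIntegral_const]
        exact ENNReal.mul_lt_top ENNReal.ofReal_lt_top measure_ball_lt_top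

omit [MeasurableSpace M] [BorelSpace M] in
-- The norms live on different fibres. They are compared with the function `a`, which uses the chart
-- differential frozen at `x` and is continuous. By continuity of the metric, the identifications of
-- nearby fibres with the fibre at `x` have norm below any `r > 1` in both directions; then `r` is
-- taken close to `1`.
lemma continuousAt_norm_differential {f : M → ℝ} {x : M}
    (hf : ContMDiffAt (𝓡 m) 𝓘(ℝ, ℝ) 1 f x) :
    ContinuousAt (fun y => ‖differential (m := m) f y‖) x := by
  set χ := chartAt (EuclideanSpace ℝ (Fin m)) x with hχ
  have hx : x ∈ χ.source := mem_chart_source _ x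
  let α : M → EuclideanSpace ℝ (Fin m) →L[ℝ] ℝ := fun y => fderiv ℝ (f ∘ χ.symm) (χ y)
  have hα : ContinuousAt α x := by
    have h1 : ContDiffAt ℝ 1 (f ∘ χ.symm) (χ x) := by
      have h2 : ContMDiffAt (𝓡 m) 𝓘(ℝ, ℝ) 1 f (χ.symm (χ x)) := by rwa [χ.left_inv hx]
      exact (h2.comp (χ x) ((contMDiffOn_chart_symm (I := 𝓡 m) (n := ∞) (x := x)).of_le
        (by simp) |>.contMDiffAt (χ.open_target.mem_nhds (χ.map_source hx)))).contDiffAt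
    exact ContinuousAt.comp (f := χ) (g := fderiv ℝ (f ∘ χ.symm))
      (h1.continuousAt_fderiv (by simp)) (χ.continuousAt hx)
  let a : M → ℝ := fun y => ‖(α y).comp (chartDeriv x x)‖
  have ha : ContinuousAt a x := by
    refine tendsto_iff_norm_sub_tendsto_zero.2 (squeeze_zero (fun y => norm_nonneg _) (fun y => ?_)
      (by simpa using (tendsto_iff_norm_sub_tendsto_zero.1 hα).mul_const (‖chartDeriv (m := m) x x‖)))
    refine (abs_norm_sub_norm_le ((α y).comp (chartDeriv x x)) ((α x).comp (chartDeriv x x))).trans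
      ?_
    rw [← ContinuousLinearMap.sub_comp]
    exact ContinuousLinearMap.opNorm_comp_le _ _
  have hN : ∀ y ∈ χ.source, differential (m := m) f y = (α y).comp (chartDeriv x y) :=
    fun y hy => differential_eq_fderiv f hy
  have hax : a x = ‖differential (m := m) f x‖ := by rw [hN x hx]
  have hsrc : ∀ᶠ y in 𝓝 x, y ∈ χ.source := χ.open_source.mem_nhds hx
  have hup : ∀ r : ℝ, 1 < r → ∀ᶠ y in 𝓝 x, ‖differential (m := m) f y‖ ≤ a y * r := by
    intro r hr
    filter_upwards [hsrc, eventually_norm_symmL_trivializationAt_self_comp_lt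
      (EuclideanSpace ℝ (Fin m)) (fun x : M => TangentSpace (𝓡 m) x) x hr] with y hy h2
    have h3 : (α y).comp (chartDeriv x y) = ((α y).comp (chartDeriv x x)).comp
        ((chartSymmDeriv x x).comp (chartDeriv x y)) := by
      ext v
      simp [chartDeriv_chartSymmDeriv hx]
    rw [hN y hy, h3]
    exact (ContinuousLinearMap.opNorm_comp_le _ _).trans (by gcongr; exact h2.le)
  have hlow : ∀ r : ℝ, 1 < r → ∀ᶠ y in 𝓝 x, a y ≤ ‖differential (m := m) f y‖ * r := by
    intro r hr
    filter_upwards [hsrc, eventually_norm_symmL_trivializationAt_comp_self_lt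
      (EuclideanSpace ℝ (Fin m)) (fun x : M => TangentSpace (𝓡 m) x) x hr] with y hy h2
    have h3 : (α y).comp (chartDeriv x x) = ((α y).comp (chartDeriv x y)).comp
        ((chartSymmDeriv x y).comp (chartDeriv x x)) := by
      ext v
      simp [chartDeriv_chartSymmDeriv hy]
    simp only [a]
    rw [hN y hy, h3]
    exact (ContinuousLinearMap.opNorm_comp_le _ _).trans (by gcongr; exact h2.le)
  rw [ContinuousAt, ← hax]
  have hr : Filter.Tendsto (fun r : ℝ => a x * r) (𝓝 1) (𝓝 (a x)) := by
    simpa using (tendsto_const_nhds (x := a x)).mul (Filter.tendsto_id (x := 𝓝 (1 : ℝ)))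
  have hr' : Filter.Tendsto (fun r : ℝ => a x * r⁻¹) (𝓝 1) (𝓝 (a x)) := by
    simpa using (tendsto_const_nhds (x := a x)).mul (tendsto_inv₀ (one_ne_zero (α := ℝ)))
  refine tendsto_order.2 ⟨fun c hc => ?_, fun c hc => ?_⟩
  · obtain ⟨r, hr1, hr2⟩ := (((hr'.mono_left nhdsWithin_le_nhds).eventually_const_lt hc).and
      (self_mem_nhdsWithin (a := (1 : ℝ)) (s := Ioi 1))).exists
    have hr0 : 0 < r := zero_lt_one.trans hr2
    have h5 : ∀ᶠ y in 𝓝 x, c < a y * r⁻¹ := (ha.mul_const r⁻¹).eventually_const_lt hr1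
    filter_upwards [h5, hlow r hr2] with y h6 h7
    exact h6.trans_le (by rw [← div_eq_mul_inv, div_le_iff₀ hr0]; exact h7)
  · obtain ⟨r, hr1, hr2⟩ := (((hr.mono_left nhdsWithin_le_nhds).eventually_lt_const hc).and
      (self_mem_nhdsWithin (a := (1 : ℝ)) (s := Ioi 1))).exists
    have h5 : ∀ᶠ y in 𝓝 x, a y * r < c := (ha.mul_const r).eventually_lt_const hr1
    filter_upwards [h5, hup r hr2] with y h6 h7
    exact h7.trans_lt h6

end Metric

/-! ### Mollification of Lipschitz functions -/

section Mollification

open Filter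

variable {E : Type*} [NormedAddCommGroup E] [InnerProductSpace ℝ E] [FiniteDimensional ℝ E]
  [MeasurableSpace E] [BorelSpace E]

/-- Convolution with a normalized bump function. -/
def mollify (ρ : ContDiffBump (0 : E)) (U : E → ℝ) : E → ℝ :=
  convolution (ρ.normed volume) U (ContinuousLinearMap.lsmul ℝ ℝ) volume

variable {L : NNReal} {U : E → ℝ} (ρ : ContDiffBump (0 : E))

lemma mollify_apply (U : E → ℝ) (z : E) :
    mollify ρ U z = ∫ t, U (z - t) * ρ.normed volume t := by
  simp [mollify, convolution_def, mul_comm]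

lemma integrable_mul_normed {V : E → ℝ} (hV : Continuous V) :
    Integrable (fun t => V t * ρ.normed volume t) := by
  refine Continuous.integrable_of_hasCompactSupport
    (hV.mul (ρ.contDiff_normed (n := 0)).continuous) ?_
  exact ρ.hasCompactSupport_normed.mul_left

lemma contDiff_mollify (hU : Continuous U) : ContDiff ℝ ∞ (mollify ρ U) :=
  ρ.hasCompactSupport_normed.contDiff_convolution_left _ ρ.contDiff_normed
    hU.locallyIntegrable

lemma mollify_sub_mollify (hU : Continuous U) (x y : E) :
    mollify ρ U x - mollify ρ U y = ∫ t, (U (x - t) - U (y - t)) * ρ.normed volume t := by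
  rw [mollify_apply, mollify_apply, ← integral_sub]
  · simp_rw [sub_mul]
  · exact integrable_mul_normed ρ (by fun_prop)
  · exact integrable_mul_normed ρ (by fun_prop)

lemma lipschitzWith_mollify (hU : LipschitzWith L U) : LipschitzWith L (mollify ρ U) := by
  refine LipschitzWith.of_dist_le_mul fun x y => ?_
  rw [Real.dist_eq, mollify_sub_mollify ρ hU.continuous]
  have hi : Integrable (fun t => L * dist x y * ρ.normed volume t) :=
    (ρ.integrable_normed (μ := volume)).const_mul (L * dist x y)
  calc |∫ t, (U (x - t) - U (y - t)) * ρ.normed volume t|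
      ≤ ∫ t, L * dist x y * ρ.normed volume t := by
        rw [← Real.norm_eq_abs]
        refine norm_integral_le_of_norm_le hi (ae_of_all _ fun t => ?_)
        rw [norm_mul, Real.norm_of_nonneg (ρ.nonneg_normed (μ := volume) t)]
        refine mul_le_mul_of_nonneg_right ?_ (ρ.nonneg_normed (μ := volume) t)
        have := hU.dist_le_mul (x - t) (y - t)
        rwa [dist_sub_right, Real.dist_eq] at this
    _ = L * dist x y := by rw [integral_const_mul, ρ.integral_normed, mul_one]

lemma dist_mollify_le (hU : LipschitzWith L U) (x : E) :
    dist (mollify ρ U x) (U x) ≤ L * ρ.rOut :=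
  ρ.dist_normed_convolution_le hU.continuous.aestronglyMeasurable fun y hy =>
    (hU.dist_le_mul y x).trans (by gcongr; exact (Metric.mem_ball.1 hy).le)

/-- Difference quotients of a Lipschitz function, integrated against an integrable kernel, converge
to the integral of its line derivative. They are also the difference quotients of the smooth
mollification, so a one-sided limit identifies the derivative. -/
lemma fderiv_mollify (hU : LipschitzWith L U) (x v : E) :
    fderiv ℝ (mollify ρ U) x v = mollify ρ (fun y => lineDeriv ℝ U y v) x := by
  have hsub : ∀ V : E → ℝ, mollify ρ V x = ∫ s, V s * ρ.normed volume (x - s) := by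
    intro V
    rw [mollify_apply, ← integral_sub_left_eq_self _ volume x]
    simp
  have h1 : Tendsto (fun h : ℝ => ∫ s, (h⁻¹ • (U (s + h • v) - U s)) * ρ.normed volume (x - s))
      (𝓝[>] 0) (𝓝 (mollify ρ (fun y => lineDeriv ℝ U y v) x)) := by
    rw [hsub]
    refine hU.integral_inv_smul_sub_mul_tendsto_integral_lineDeriv_mul ?_ v
    exact ρ.integrable_normed.comp_sub_left x
  have h2 : HasLineDerivAt ℝ (mollify ρ U) (fderiv ℝ (mollify ρ U) x v) x v :=
    (((contDiff_mollify ρ hU.continuous).differentiable (by simp)) x).hasFDerivAt.hasLineDerivAt v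
  have h3 : Tendsto (fun h : ℝ => h⁻¹ • (mollify ρ U (x + h • v) - mollify ρ U x))
      (𝓝[>] 0) (𝓝 (fderiv ℝ (mollify ρ U) x v)) :=
    h2.tendsto_slope_zero_right
  refine tendsto_nhds_unique h3 (h1.congr fun h => ?_)
  rw [mollify_sub_mollify ρ hU.continuous, ← integral_sub_left_eq_self _ volume x, smul_eq_mul,
    ← integral_const_mul]
  congr 1 with s
  simp only [sub_sub_cancel, smul_eq_mul]
  rw [show x + h • v - s = x - s + h • v by abel]
  ring

/-- Lipschitz functions are limits of smooth Lipschitz functions, together with their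
differentials almost everywhere. -/
lemma exists_smooth_approximation (hU : LipschitzWith L U) :
    ∃ W : ℕ → E → ℝ, (∀ n, ContDiff ℝ ∞ (W n)) ∧ (∀ n, LipschitzWith L (W n)) ∧
      TendstoUniformly W U atTop ∧
      ∀ᵐ z, ∀ v, Tendsto (fun n => fderiv ℝ (W n) z v) atTop (𝓝 (fderiv ℝ U z v)) := by
  -- The ratio of outer to inner radius is kept equal to `2`: a bounded ratio is what the almost
  -- everywhere convergence of the mollified line derivatives requires.
  let ρ : ℕ → ContDiffBump (0 : E) := fun n =>
    ⟨1 / ((n : ℝ) + 1) / 2, 1 / ((n : ℝ) + 1), by positivity, half_lt_self (by positivity)⟩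
  have hρ : Tendsto (fun n => (ρ n).rOut) atTop (𝓝 0) := tendsto_one_div_add_atTop_nhds_zero_nat
  refine ⟨fun n => mollify (ρ n) U, fun n => contDiff_mollify _ hU.continuous,
    fun n => lipschitzWith_mollify _ hU, ?_, ?_⟩
  · rw [Metric.tendstoUniformly_iff]
    intro ε hε
    have h1 : Tendsto (fun n => L * (ρ n).rOut) atTop (𝓝 0) := by simpa using hρ.const_mul (L : ℝ)
    filter_upwards [h1.eventually_lt_const hε] with n hn x
    rw [dist_comm]
    exact (dist_mollify_le (ρ n) hU x).trans_lt hn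
  · set B := stdOrthonormalBasis ℝ E
    have h2 : ∀ i, ∀ᵐ z, Tendsto (fun n => mollify (ρ n) (fun y => lineDeriv ℝ U y (B i)) z)
        atTop (𝓝 (lineDeriv ℝ U z (B i))) := fun i =>
      ContDiffBump.ae_convolution_tendsto_right_of_locallyIntegrable (K := 2) hρ
        (Eventually.of_forall fun n => by simp only [ρ]; linarith)
        (hU.locallyIntegrable_lineDeriv (B i))
    filter_upwards [ae_all_iff.2 h2, hU.ae_differentiableAt] with z hz hd v
    have h3 : ∀ T : E →L[ℝ] ℝ, T v = ∑ i, B.repr v i * T (B i) := by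
      intro T
      conv_lhs => rw [← B.sum_repr v]
      simp
    simp_rw [h3 (fderiv ℝ _ z)]
    refine tendsto_finsetSum _ fun i _ => Tendsto.const_mul _ ?_
    simp_rw [fderiv_mollify (ρ _) hU, ← hd.lineDeriv_eq_fderiv]
    exact hz i

end Mollification

/-! ### Local smoothing on the manifold and measurability of gradients -/

section Smoothing

open Filter

variable {m : ℕ} {M : Type*} [EMetricSpace M] [ChartedSpace (EuclideanSpace ℝ (Fin m)) M]
  [IsManifold (𝓡 m) ∞ M] [RiemannianBundle (fun x : M => TangentSpace (𝓡 m) x)]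

lemma norm_grad (f : M → ℝ) (x : M) : ‖grad (m := m) f x‖ = ‖differential (m := m) f x‖ :=
  LinearIsometryEquiv.norm_map _ _

lemma inner_grad_left (f : M → ℝ) (x : M) (v : TangentSpace (𝓡 m) x) :
    inner ℝ (grad (m := m) f x) v = differential f x v :=
  InnerProductSpace.toDual_symm_apply

lemma inner_grad_right (f : M → ℝ) (x : M) (v : TangentSpace (𝓡 m) x) :
    inner ℝ v (grad (m := m) f x) = differential f x v := by
  rw [real_inner_comm, inner_grad_left]

lemma differential_congr {f g : M → ℝ} {x : M} (h : f =ᶠ[𝓝 x] g) :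
    differential (m := m) f x = differential g x :=
  h.mfderiv_eq

lemma grad_congr {f g : M → ℝ} {x : M} (h : f =ᶠ[𝓝 x] g) :
    grad (m := m) f x = grad g x :=
  congrArg (InnerProductSpace.toDual ℝ (TangentSpace (𝓡 m) x)).symm (differential_congr h)

variable [MeasurableSpace M]

/-- The smooth functions `w n` converge to `u` on the open set `V` of finite measure, uniformly,
and together with their differentials almost everywhere; the differentials are bounded by `C`. -/
structure IsSmoothing (u : M → ℝ) (V : Set M) (C : ℝ) (w : ℕ → M → ℝ) : Prop where
  isOpen : IsOpen V
  measure_lt_top : riemannianMeasure m M V < ⊤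
  contMDiffOn : ∀ n, ContMDiffOn (𝓡 m) 𝓘(ℝ, ℝ) ∞ (w n) V
  tendsto : TendstoUniformlyOn w u atTop V
  norm_le : ∀ n, ∀ x ∈ V, ‖grad (m := m) (w n) x‖ ≤ C
  norm_limit_le : ∀ x ∈ V, ‖grad (m := m) u x‖ ≤ C
  ae_tendsto : ∀ᵐ x ∂(riemannianMeasure m M), x ∈ V → ∀ v : TangentSpace (𝓡 m) x,
    Tendsto (fun n => differential (w n) x v) atTop (𝓝 (differential u x v))

/-- A locally Lipschitz function can be smoothed near every point. -/
lemma exists_isSmoothing [BorelSpace M] [IsRiemannianManifold (𝓡 m) M]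
    [IsContinuousRiemannianBundle (EuclideanSpace ℝ (Fin m))
      (fun x : M => TangentSpace (𝓡 m) x)]
    {u : M → ℝ} (hu : LocallyLipschitz u) (x₀ : M) :
    ∃ V C w, x₀ ∈ V ∧ IsSmoothing (m := m) u V C w := by
  obtain ⟨A, r, hr, htar, hA⟩ := exists_lipschitzOnWith_chartAt_symm (m := m) x₀
  obtain ⟨K, t, ht, hK⟩ := hu x₀
  obtain ⟨D, hD, hDev⟩ := eventually_norm_chartDeriv_lt (m := m) x₀
  obtain ⟨V₀, hV₀, hV₀fin⟩ := exists_nhds_riemannianMeasure_lt_top (m := m) x₀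
  set χ := chartAt (EuclideanSpace ℝ (Fin m)) x₀ with hχ
  have hx : x₀ ∈ χ.source := mem_chart_source _ x₀
  have hsymm : χ.symm ⁻¹' t ∈ 𝓝 (χ x₀) := by
    have h3 := χ.continuousAt_symm (χ.map_source hx)
    rw [ContinuousAt, χ.left_inv hx] at h3
    exact h3 ht
  obtain ⟨r', hr', hball⟩ := Metric.mem_nhds_iff.1 (inter_mem hsymm (Metric.ball_mem_nhds _ hr))
  set B := Metric.ball (χ x₀) r' with hB
  have hBtar : B ⊆ χ.target := fun z hz => htar (hball hz).2
  have hlip : LipschitzOnWith (K * A) (u ∘ χ.symm) B :=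
    hK.comp (hA.mono fun z hz => (hball hz).2) fun z hz => (hball hz).1
  -- Extending to the whole coordinate space allows mollification without loss of domain.
  obtain ⟨U, hU, hUeq⟩ := hlip.extend_real
  obtain ⟨W, hWs, hWl, hWu, hWd⟩ := exists_smooth_approximation hU
  set V := (χ.source ∩ χ ⁻¹' B) ∩ (interior V₀ ∩ interior {y | ‖chartDeriv (m := m) x₀ y‖ < D})
    with hV
  have hVs : ∀ x ∈ V, x ∈ χ.source := fun x hx => hx.1.1
  have hVB : ∀ x ∈ V, χ x ∈ B := fun x hx => hx.1.2
  have hVD : ∀ x ∈ V, ‖chartDeriv (m := m) x₀ x‖ ≤ D := fun x hx =>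
    le_of_lt (interior_subset hx.2.2 : x ∈ {y | ‖chartDeriv (m := m) x₀ y‖ < D})
  have hdu : ∀ x ∈ V, differential (m := m) u x =
      (fderiv ℝ U (χ x)).comp (chartDeriv x₀ x) := by
    intro x hxV
    rw [differential_eq_fderiv u (hVs x hxV)]
    congr 1
    refine Filter.EventuallyEq.fderiv_eq ?_
    filter_upwards [Metric.isOpen_ball.mem_nhds (hVB x hxV)] with z hz
    exact hUeq hz
  have hdw : ∀ n, ∀ x ∈ V, differential (m := m) (W n ∘ χ) x =
      (fderiv ℝ (W n) (χ x)).comp (chartDeriv x₀ x) := by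
    intro n x hxV
    rw [differential_eq_fderiv _ (hVs x hxV)]
    congr 1
    refine Filter.EventuallyEq.fderiv_eq ?_
    filter_upwards [χ.open_target.mem_nhds (χ.map_source (hVs x hxV))] with z hz
    simp [← hχ, χ.right_inv hz]
  have hbd : ∀ (T : EuclideanSpace ℝ (Fin m) →L[ℝ] ℝ), ‖T‖ ≤ (K * A : NNReal) → ∀ x ∈ V,
      ‖T.comp (chartDeriv (m := m) x₀ x)‖ ≤ (K * A : NNReal) * D := fun T hT x hxV =>
    (ContinuousLinearMap.opNorm_comp_le _ _).trans (by gcongr; exact hVD x hxV)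
  refine ⟨V, (K * A : NNReal) * D, fun n => W n ∘ χ,
    ⟨⟨hx, Metric.mem_ball_self hr'⟩, mem_interior_iff_mem_nhds.2 hV₀,
      mem_interior_iff_mem_nhds.2 hDev⟩, ⟨?_, ?_, ?_, ?_, ?_, ?_, ?_⟩⟩
  · exact (χ.isOpen_inter_preimage Metric.isOpen_ball).inter (isOpen_interior.inter isOpen_interior)
  · exact (measure_mono fun x hx => interior_subset hx.2.1).trans_lt hV₀fin
  · intro n
    exact (hWs n).contMDiff.comp_contMDiffOn
      ((contMDiffOn_chart (I := 𝓡 m) (n := ∞) (x := x₀)).mono hVs)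
  · rw [Metric.tendstoUniformlyOn_iff]
    intro ε hε
    filter_upwards [Metric.tendstoUniformly_iff.1 hWu ε hε] with n hn x hxV
    have h1 : u x = U (χ x) := by
      rw [← hUeq (hVB x hxV)]
      simp [χ.left_inv (hVs x hxV)]
    rw [h1]
    exact hn (χ x)
  · intro n x hxV
    rw [norm_grad, hdw n x hxV]
    exact hbd _ (norm_fderiv_le_of_lipschitz ℝ (hWl n)) x hxV
  · intro x hxV
    rw [norm_grad, hdu x hxV]
    exact hbd _ (norm_fderiv_le_of_lipschitz ℝ hU) x hxV
  · filter_upwards [ae_chart (x₀ := x₀) hWd] with x hx hxV v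
    rw [hdu x hxV]
    simp_rw [hdw _ x hxV]
    exact hx (hVs x hxV) _

variable [IsContinuousRiemannianBundle (EuclideanSpace ℝ (Fin m))
      (fun x : M => TangentSpace (𝓡 m) x)]

omit [MeasurableSpace M] in
lemma continuousAt_norm_grad {f : M → ℝ} {x : M} (hf : ContMDiffAt (𝓡 m) 𝓘(ℝ, ℝ) 1 f x) :
    ContinuousAt (fun y => ‖grad (m := m) f y‖) x := by
  simp_rw [norm_grad]
  exact continuousAt_norm_differential hf

omit [MeasurableSpace M] in
-- Polarization reduces this to the continuity of the norms of the gradients of `f + g` and `f - g`.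
lemma continuousAt_inner_grad {f g : M → ℝ} {x : M} (hf : ContMDiffAt (𝓡 m) 𝓘(ℝ, ℝ) 1 f x)
    (hg : ContMDiffAt (𝓡 m) 𝓘(ℝ, ℝ) 1 g x) :
    ContinuousAt (fun y => inner ℝ (grad (m := m) f y) (grad (m := m) g y)) x := by
  have h1 : ContinuousAt (fun y => (‖grad (m := m) (f + g) y‖ ^ 2 -
      ‖grad (m := m) (f - g) y‖ ^ 2) / 4) x :=
    (((continuousAt_norm_grad (hf.add hg)).pow 2).sub
      ((continuousAt_norm_grad (hf.sub hg)).pow 2)).div_const 4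
  refine h1.congr ?_
  have hf' : ∀ᶠ y in 𝓝 x, MDifferentiableAt (𝓡 m) 𝓘(ℝ, ℝ) f y :=
    (contMDiffAt_iff_contMDiffAt_nhds (by simp) |>.1 hf).mono fun y hy => hy.mdifferentiableAt (by simp)
  have hg' : ∀ᶠ y in 𝓝 x, MDifferentiableAt (𝓡 m) 𝓘(ℝ, ℝ) g y :=
    (contMDiffAt_iff_contMDiffAt_nhds (by simp) |>.1 hg).mono fun y hy => hy.mdifferentiableAt (by simp)
  filter_upwards [hf', hg'] with y hfy hgy
  have hadd : grad (m := m) (f + g) y = grad f y + grad g y := by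
    refine ext_inner_right ℝ fun v => ?_
    rw [inner_add_left, inner_grad_left, inner_grad_left, inner_grad_left]
    exact congrArg (fun L : TangentSpace (𝓡 m) y →L[ℝ] ℝ => L v)
      (hfy.hasMFDerivAt.add hgy.hasMFDerivAt).mfderiv
  have hsub : grad (m := m) (f - g) y = grad f y - grad g y := by
    refine ext_inner_right ℝ fun v => ?_
    rw [inner_sub_left, inner_grad_left, inner_grad_left, inner_grad_left]
    exact congrArg (fun L : TangentSpace (𝓡 m) y →L[ℝ] ℝ => L v)
      (hfy.hasMFDerivAt.sub hgy.hasMFDerivAt).mfderiv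
  rw [hadd, hsub, norm_add_sq_real, norm_sub_sq_real]
  ring

variable [BorelSpace M] {u : M → ℝ} {V : Set M} {C : ℝ} {w : ℕ → M → ℝ}

lemma IsSmoothing.aestronglyMeasurable_inner (h : IsSmoothing (m := m) u V C w) {g : M → ℝ}
    (hg : ContMDiffOn (𝓡 m) 𝓘(ℝ, ℝ) ∞ g V) :
    AEStronglyMeasurable (fun x => inner ℝ (grad (m := m) u x) (grad (m := m) g x))
      ((riemannianMeasure m M).restrict V) := by
  refine aestronglyMeasurable_of_tendsto_ae atTop
    (f := fun n x => inner ℝ (grad (m := m) (w n) x) (grad (m := m) g x)) (fun n => ?_) ?_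
  · refine ContinuousOn.aestronglyMeasurable (fun x hx => ?_) h.isOpen.measurableSet
    exact (continuousAt_inner_grad
      (((h.contMDiffOn n).contMDiffAt (h.isOpen.mem_nhds hx)).of_le (by simp))
      ((hg.contMDiffAt (h.isOpen.mem_nhds hx)).of_le (by simp))).continuousWithinAt
  · rw [ae_restrict_iff' h.isOpen.measurableSet]
    filter_upwards [h.ae_tendsto] with x hx hxV
    simp_rw [inner_grad_left]
    exact hx hxV _

/-- A second passage to the limit: `⟨∇u, ∇w n⟩` is measurable by the previous lemma and converges
almost everywhere to `|∇u|²`. -/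
lemma IsSmoothing.aestronglyMeasurable_norm (h : IsSmoothing (m := m) u V C w) :
    AEStronglyMeasurable (fun x => ‖grad (m := m) u x‖)
      ((riemannianMeasure m M).restrict V) := by
  have h1 : AEStronglyMeasurable (fun x => inner ℝ (grad (m := m) u x) (grad (m := m) u x))
      ((riemannianMeasure m M).restrict V) := by
    refine aestronglyMeasurable_of_tendsto_ae atTop
      (f := fun n x => inner ℝ (grad (m := m) u x) (grad (m := m) (w n) x))
      (fun n => h.aestronglyMeasurable_inner (h.contMDiffOn n)) ?_
    rw [ae_restrict_iff' h.isOpen.measurableSet]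
    filter_upwards [h.ae_tendsto] with x hx hxV
    simp_rw [inner_grad_right]
    exact hx hxV _
  have h2 : (fun x => ‖grad (m := m) u x‖) =
      fun x => Real.sqrt (inner ℝ (grad (m := m) u x) (grad (m := m) u x)) := by
    ext x
    rw [real_inner_self_eq_norm_sq, Real.sqrt_sq (norm_nonneg _)]
  rw [h2]
  exact Real.continuous_sqrt.comp_aestronglyMeasurable h1

end Smoothing

/-! ### Cutoff functions of one variable -/

section Cutoff

open Filter

/-- A smooth nondecreasing function with values in `[0, 1]`, vanishing on `(-∞, δ]`, with bounded
derivative. -/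
structure IsCutoff (δ : ℝ) (χ : ℝ → ℝ) : Prop where
  contDiff : ContDiff ℝ ∞ χ
  nonneg : ∀ t, 0 ≤ χ t
  le_one : ∀ t, χ t ≤ 1
  eq_zero : ∀ t, t ≤ δ → χ t = 0
  deriv_nonneg : ∀ t, 0 ≤ deriv χ t
  deriv_le : ∃ B, ∀ t, deriv χ t ≤ B

lemma exists_isCutoff (η : ℝ) :
    ∃ χ : ℕ → ℝ → ℝ, (∀ n, ∃ δ, η < δ ∧ IsCutoff δ (χ n)) ∧
      ∀ t, η < t → Tendsto (fun n => χ n t) atTop (𝓝 1) := by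
  have hS : ContDiff ℝ ∞ Real.smoothTransition := Real.smoothTransition.contDiff
  have hd : ∀ n : ℕ, ∀ t, HasDerivAt
      (fun t => Real.smoothTransition (((n : ℝ) + 1) * (t - η) - 1))
      (deriv Real.smoothTransition (((n : ℝ) + 1) * (t - η) - 1) * ((n : ℝ) + 1)) t := by
    intro n t
    have h1 : HasDerivAt (fun t : ℝ => ((n : ℝ) + 1) * (t - η) - 1) ((n : ℝ) + 1) t := by
      simpa using (((hasDerivAt_id t).sub_const η).const_mul ((n : ℝ) + 1)).sub_const 1
    exact ((hS.differentiable (by simp)) _).hasDerivAt.comp t h1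
  have hB : ∃ B, 0 ≤ B ∧ ∀ s, deriv Real.smoothTransition s ≤ B := by
    obtain ⟨B, hB⟩ := (isCompact_Icc (a := (0 : ℝ)) (b := 1)).exists_bound_of_continuousOn
      (hS.continuous_deriv (by simp)).continuousOn
    have hB0 : 0 ≤ B := (norm_nonneg _).trans (hB 0 (by simp))
    refine ⟨B, hB0, fun s => ?_⟩
    rcases lt_or_ge s 0 with hs | hs
    · have : Real.smoothTransition =ᶠ[𝓝 s] fun _ => 0 := by
        filter_upwards [eventually_lt_nhds hs] with t ht
        exact Real.smoothTransition.zero_of_nonpos ht.le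
      rw [this.deriv_eq]
      simpa using hB0
    rcases lt_or_ge 1 s with hs1 | hs1
    · have : Real.smoothTransition =ᶠ[𝓝 s] fun _ => 1 := by
        filter_upwards [eventually_gt_nhds hs1] with t ht
        exact Real.smoothTransition.one_of_one_le ht.le
      rw [this.deriv_eq]
      simpa using hB0
    · exact (le_abs_self _).trans (hB s ⟨hs, hs1⟩)
  obtain ⟨B, hB0, hB⟩ := hB
  -- The transition takes place between `η + 1/(n+1)` and `η + 2/(n+1)`. The shift by `1` makes the
  -- function vanish up to a level strictly above `η`.
  refine ⟨fun n t => Real.smoothTransition (((n : ℝ) + 1) * (t - η) - 1), fun n => ?_, ?_⟩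
  · have hn : (0 : ℝ) < n + 1 := by positivity
    refine ⟨η + 1 / (n + 1), by simpa using by positivity, ?_, ?_, ?_, ?_, ?_, ?_⟩
    · exact hS.comp (by fun_prop)
    · exact fun t => Real.smoothTransition.nonneg _
    · exact fun t => Real.smoothTransition.le_one _
    · intro t ht
      refine Real.smoothTransition.zero_of_nonpos ?_
      have h1 : t - η ≤ 1 / ((n : ℝ) + 1) := by linarith
      have h2 := (le_div_iff₀' hn).1 h1
      linarith
    · intro t
      rw [(hd n t).deriv]
      exact mul_nonneg (Real.smoothTransition.monotone.deriv_nonneg) hn.le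
    · refine ⟨B * (n + 1), fun t => ?_⟩
      rw [(hd n t).deriv]
      exact mul_le_mul_of_nonneg_right (hB _) hn.le
  · intro t ht
    refine tendsto_const_nhds.congr' ?_
    obtain ⟨N, hN⟩ := exists_nat_gt (2 / (t - η))
    filter_upwards [eventually_ge_atTop N] with n hn
    refine (Real.smoothTransition.one_of_one_le ?_).symm
    have h0 : 0 < t - η := by linarith
    have h1 : 2 / (t - η) ≤ (n : ℝ) + 1 := by
      have : (N : ℝ) ≤ n := by exact_mod_cast hn
      linarith
    have h2 := (div_le_iff₀ h0).1 h1
    linarith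

end Cutoff

/-! ### Integrability of the source and flux terms -/

section Integrability

open Filter

variable {m : ℕ} {M : Type*} [EMetricSpace M] [ChartedSpace (EuclideanSpace ℝ (Fin m)) M]
  [IsManifold (𝓡 m) ∞ M] [RiemannianBundle (fun x : M => TangentSpace (𝓡 m) x)]
  [IsContinuousRiemannianBundle (EuclideanSpace ℝ (Fin m)) (fun x : M => TangentSpace (𝓡 m) x)]
  [IsRiemannianManifold (𝓡 m) M] [MeasurableSpace M] [BorelSpace M]

/-- The integrand of the flux of the field `φ(|∇u|) |∇u|⁻¹ ∇u`. -/
def fluxDensity (φ : ℝ → ℝ) (u ψ : M → ℝ) (x : M) : ℝ :=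
  φ ‖grad (m := m) u x‖ / ‖grad (m := m) u x‖ *
    inner ℝ (grad (m := m) u x) (grad (m := m) ψ x)

omit [IsContinuousRiemannianBundle (EuclideanSpace ℝ (Fin m))
  (fun x : M => TangentSpace (𝓡 m) x)] [IsRiemannianManifold (𝓡 m) M] [MeasurableSpace M]
  [BorelSpace M] in
lemma abs_div_norm_mul_inner_le (a : ℝ) (u : M → ℝ) (x : M) (v : TangentSpace (𝓡 m) x) :
    |a / ‖grad (m := m) u x‖ * inner ℝ (grad (m := m) u x) v| ≤ |a| * ‖v‖ := by
  rcases eq_or_ne ‖grad (m := m) u x‖ 0 with h | h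
  · rw [h]; simp; positivity
  · rw [abs_mul, abs_div, abs_norm]
    calc _ ≤ |a| / ‖grad (m := m) u x‖ * (‖grad (m := m) u x‖ * ‖v‖) := by
          gcongr; exact abs_real_inner_le_norm _ _
      _ = |a| * ‖v‖ := by field_simp

omit [IsContinuousRiemannianBundle (EuclideanSpace ℝ (Fin m))
  (fun x : M => TangentSpace (𝓡 m) x)] [IsRiemannianManifold (𝓡 m) M] [MeasurableSpace M]
  [BorelSpace M] in
lemma fluxDensity_of_notMem_tsupport (φ : ℝ → ℝ) (u : M → ℝ) {ψ : M → ℝ} {x : M}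
    (hx : x ∉ tsupport ψ) : fluxDensity (m := m) φ u ψ x = 0 := by
  have h : ψ =ᶠ[𝓝 x] fun _ => 0 := notMem_tsupport_iff_eventuallyEq.1 hx
  have h2 : differential (m := m) ψ x = 0 := by
    rw [differential_congr h]
    exact mfderiv_const
  rw [fluxDensity, inner_grad_right, h2]
  simp

/-- Only arguments that are norms occur, so the truncated function has the same values there while
being continuous on all of `ℝ`. -/
lemma continuous_comp_max {φ : ℝ → ℝ} (hφ : ContinuousOn φ (Ici 0)) :
    Continuous fun t => φ (max 0 t) :=
  hφ.comp_continuous (by fun_prop) fun t => le_max_left 0 t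

variable {u : M → ℝ}

lemma locallyIntegrable_comp_norm_grad (hu : LocallyLipschitz u) {l : ℝ → ℝ}
    (hl : ContinuousOn l (Ici 0)) :
    LocallyIntegrable (fun x => l ‖grad (m := m) u x‖) (riemannianMeasure m M) := by
  intro x₀
  obtain ⟨V, C, w, hxV, h⟩ := exists_isSmoothing (m := m) hu x₀
  refine ⟨V, h.isOpen.mem_nhds hxV, ?_⟩
  obtain ⟨B, hB⟩ := (isCompact_Icc (a := (0 : ℝ)) (b := C)).exists_bound_of_continuousOn
      (hl.mono Icc_subset_Ici_self)
  have : IsFiniteMeasure ((riemannianMeasure m M).restrict V) :=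
    ⟨by simpa using h.measure_lt_top⟩
  refine Integrable.of_bound ?_ B ?_
  · have := (continuous_comp_max hl).comp_aestronglyMeasurable h.aestronglyMeasurable_norm
    simpa using this
  · rw [ae_restrict_iff' h.isOpen.measurableSet]
    exact ae_of_all _ fun x hx => hB _ ⟨norm_nonneg _, h.norm_limit_le x hx⟩

lemma locallyIntegrable_fluxDensity (hu : LocallyLipschitz u) {φ : ℝ → ℝ}
    (hφ : ContinuousOn φ (Ici 0)) {ψ : M → ℝ} (hψ : ContMDiff (𝓡 m) 𝓘(ℝ, ℝ) ∞ ψ) :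
    LocallyIntegrable (fluxDensity (m := m) φ u ψ) (riemannianMeasure m M) := by
  intro x₀
  obtain ⟨V, C, w, hxV, h⟩ := exists_isSmoothing (m := m) hu x₀
  have h1 : ∀ᶠ x in 𝓝 x₀, ‖grad (m := m) ψ x‖ < ‖grad (m := m) ψ x₀‖ + 1 :=
    (continuousAt_norm_grad ((hψ x₀).of_le (by simp))).eventually_lt_const (by linarith)
  obtain ⟨T, hT, hTo, hxT⟩ := mem_nhds_iff.1 (inter_mem (h.isOpen.mem_nhds hxV) h1)
  refine ⟨T, hTo.mem_nhds hxT, ?_⟩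
  obtain ⟨B, hB⟩ := (isCompact_Icc (a := (0 : ℝ)) (b := C)).exists_bound_of_continuousOn
      (hφ.mono Icc_subset_Ici_self)
  have : IsFiniteMeasure ((riemannianMeasure m M).restrict T) :=
    ⟨by simpa using (measure_mono fun x hx => (hT hx).1).trans_lt h.measure_lt_top⟩
  refine Integrable.of_bound ?_ (B * (‖grad (m := m) ψ x₀‖ + 1)) ?_
  · refine AEStronglyMeasurable.mono_measure ?_
      (Measure.restrict_mono (fun x hx => (hT hx).1) le_rfl)
    refine AEStronglyMeasurable.mul ?_ (h.aestronglyMeasurable_inner hψ.contMDiffOn)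
    have h2 : Measurable fun t => φ (max 0 t) / t :=
      (continuous_comp_max hφ).measurable.div measurable_id
    have h3 := (h2.comp_aemeasurable h.aestronglyMeasurable_norm.aemeasurable).aestronglyMeasurable
    simpa [Function.comp_def] using h3
  · rw [ae_restrict_iff' hTo.measurableSet]
    refine ae_of_all _ fun x hx => (abs_div_norm_mul_inner_le _ u x _).trans ?_
    have hb := hB _ ⟨norm_nonneg _, h.norm_limit_le x (hT hx).1⟩
    have hc : ‖grad (m := m) ψ x‖ < ‖grad (m := m) ψ x₀‖ + 1 := (hT hx).2
    exact mul_le_mul hb hc.le (norm_nonneg _) ((norm_nonneg _).trans hb)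

lemma integrable_fluxDensity (hu : LocallyLipschitz u) {φ : ℝ → ℝ}
    (hφ : ContinuousOn φ (Ici 0)) {ψ : M → ℝ} (hψ : ContMDiff (𝓡 m) 𝓘(ℝ, ℝ) ∞ ψ)
    (hψc : HasCompactSupport ψ) :
    Integrable (fluxDensity (m := m) φ u ψ) (riemannianMeasure m M) := by
  refine (integrableOn_iff_integrable_of_support_subset (s := tsupport ψ) fun x hx => ?_).1
    ((locallyIntegrable_fluxDensity hu hφ hψ).integrableOn_isCompact hψc)
  by_contra h
  exact hx (fluxDensity_of_notMem_tsupport φ u h)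

lemma integrable_mul_comp_norm_grad (hu : LocallyLipschitz u) {l : ℝ → ℝ}
    (hl : ContinuousOn l (Ici 0)) {g : M → ℝ} (hg : Continuous g) (hgc : HasCompactSupport g) :
    Integrable (fun x => g x * l ‖grad (m := m) u x‖) (riemannianMeasure m M) := by
  have h := locallyIntegrable_comp_norm_grad (m := m) hu hl
  simpa only [smul_eq_mul] using h.integrable_smul_left_of_hasCompactSupport hg hgc

end Integrability

/-! ### Testing across the level set, locally -/

section LocalInequality

open Filter

variable {m : ℕ} {M : Type*} [EMetricSpace M] [ChartedSpace (EuclideanSpace ℝ (Fin m)) M]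
  [IsManifold (𝓡 m) ∞ M] [RiemannianBundle (fun x : M => TangentSpace (𝓡 m) x)]
  {φ l χ : ℝ → ℝ} {b u ψ : M → ℝ} {V : Set M} {C K η δ : ℝ} {w : ℕ → M → ℝ}

lemma contMDiff_cutoff_mul {v : M → ℝ} (hV : IsOpen V)
    (hv : ContMDiffOn (𝓡 m) 𝓘(ℝ, ℝ) ∞ v V) (hχ : ContDiff ℝ ∞ χ)
    (hψ : ContMDiff (𝓡 m) 𝓘(ℝ, ℝ) ∞ ψ) (hψV : tsupport ψ ⊆ V) :
    ContMDiff (𝓡 m) 𝓘(ℝ, ℝ) ∞ (fun x => χ (v x) * ψ x) := by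
  refine contMDiff_of_tsupport fun x hx => ?_
  have hxV : x ∈ V := hψV (tsupport_mul_subset_right hx)
  exact (hχ.contMDiff.contMDiffAt.comp x (hv.contMDiffAt (hV.mem_nhds hxV))).mul (hψ x)

lemma differential_cutoff_mul {v : M → ℝ} {x : M}
    (hv : MDifferentiableAt (𝓡 m) 𝓘(ℝ, ℝ) v x) (hχ : ContDiff ℝ ∞ χ)
    (hψ : MDifferentiableAt (𝓡 m) 𝓘(ℝ, ℝ) ψ x) (y : TangentSpace (𝓡 m) x) :
    differential (m := m) (fun x => χ (v x) * ψ x) x y =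
      χ (v x) * differential ψ x y + ψ x * deriv χ (v x) * differential v x y := by
  have h1 := ((hχ.differentiable (by simp)) (v x)).hasDerivAt.hasFDerivAt.hasMFDerivAt
  have h2 := (HasMFDerivAt.comp x h1 hv.hasMFDerivAt).mul hψ.hasMFDerivAt
  have h3 := congrArg (fun L : TangentSpace (𝓡 m) x →L[ℝ] ℝ => L y) h2.mfderiv
  refine h3.trans ?_
  change χ (v x) * differential ψ x y + ψ x * (differential v x y * deriv χ (v x)) = _
  ring

lemma fluxDensity_cutoff_mul {v : M → ℝ} {x : M}
    (hv : MDifferentiableAt (𝓡 m) 𝓘(ℝ, ℝ) v x) (hχ : ContDiff ℝ ∞ χ)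
    (hψ : MDifferentiableAt (𝓡 m) 𝓘(ℝ, ℝ) ψ x) :
    fluxDensity (m := m) φ u (fun x => χ (v x) * ψ x) x =
      χ (v x) * fluxDensity (m := m) φ u ψ x +
        ψ x * deriv χ (v x) * fluxDensity (m := m) φ u v x := by
  simp only [fluxDensity, inner_grad_right]
  rw [differential_cutoff_mul hv hχ hψ]
  ring

variable [MeasurableSpace M]

/-- Where the product is nonzero, `w n > δ`; once `w n` is within `(δ - η)/2` of `u`, this forces `u
≥ (δ + η)/2`, a closed condition that survives passing to the closure of the support. -/
lemma IsSmoothing.eventually_tsupport_subset (h : IsSmoothing (m := m) u V C w)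
    (hu : Continuous u) (hψV : tsupport ψ ⊆ V) (hχ : IsCutoff δ χ) (hδ : η < δ) :
    ∀ᶠ n in atTop, tsupport (fun x => χ (w n x) * ψ x) ⊆ {x | η < u x} := by
  filter_upwards [Metric.tendstoUniformlyOn_iff.1 h.tendsto ((δ - η) / 2) (by linarith)] with n hn
  have hclosed : IsClosed (tsupport ψ ∩ {x | (δ + η) / 2 ≤ u x}) :=
    (isClosed_tsupport ψ).inter (isClosed_le continuous_const hu)
  have hsub : tsupport (fun x => χ (w n x) * ψ x) ⊆ tsupport ψ ∩ {x | (δ + η) / 2 ≤ u x} := by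
    refine closure_minimal (fun x hx => ?_) hclosed
    rw [Function.mem_support, mul_ne_zero_iff] at hx
    have hxψ : x ∈ tsupport ψ := subset_tsupport ψ hx.2
    refine ⟨hxψ, ?_⟩
    have h1 : δ < w n x := by
      by_contra hle
      exact hx.1 (hχ.eq_zero _ (not_lt.1 hle))
    have h2 := hn x (hψV hxψ)
    rw [Real.dist_eq, abs_lt] at h2
    change (δ + η) / 2 ≤ u x
    linarith [h2.1]
  exact fun x hx => by
    have := (hsub hx).2
    change η < u x
    change (δ + η) / 2 ≤ u x at this
    linarith

variable [IsContinuousRiemannianBundle (EuclideanSpace ℝ (Fin m)) (fun x : M => TangentSpace (𝓡 m) x)]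
  [IsRiemannianManifold (𝓡 m) M] [BorelSpace M]

omit [MeasurableSpace M] [IsRiemannianManifold (𝓡 m) M] [BorelSpace M] in
lemma exists_norm_grad_le (hψ : ContMDiff (𝓡 m) 𝓘(ℝ, ℝ) ∞ ψ) (hψc : HasCompactSupport ψ) :
    ∃ B, ∀ x, ‖grad (m := m) ψ x‖ ≤ B := by
  have hc : Continuous fun x => ‖grad (m := m) ψ x‖ :=
    continuous_iff_continuousAt.2 fun x => continuousAt_norm_grad ((hψ x).of_le (by simp))
  obtain ⟨B, hB⟩ := IsCompact.exists_bound_of_continuousOn (s := tsupport ψ) hψc hc.continuousOn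
  refine ⟨max B 0, fun x => ?_⟩
  by_cases hx : x ∈ tsupport ψ
  · exact (le_abs_self _).trans ((hB x hx).trans (le_max_left _ _))
  · rw [norm_grad, differential_congr (notMem_tsupport_iff_eventuallyEq.1 hx)]
    have : differential (m := m) (fun _ : M => (0 : ℝ)) x = 0 := mfderiv_const
    change ‖differential (m := m) (fun _ : M => (0 : ℝ)) x‖ ≤ _
    rw [this]
    exact (norm_zero (E := TangentSpace (𝓡 m) x →L[ℝ] ℝ)).le.trans (le_max_right _ _)

/-- A weak inequality on `{η < u}` may be tested with functions cut off by a function of `u`; the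
term that contains the derivative of the cutoff has a sign. -/
lemma IsSmoothing.setIntegral_cutoff_le (h : IsSmoothing (m := m) u V C w)
    (hu : LocallyLipschitz u) (hφ : ContinuousOn φ (Ici 0)) (hφ0 : ∀ t, 0 ≤ t → 0 ≤ φ t)
    (hl : ContinuousOn l (Ici 0)) (hb : Continuous b)
    (hsub : IsSubsolution (m := m) φ b (fun _ => K) l {x | η < u x} u)
    (hψ : ContMDiff (𝓡 m) 𝓘(ℝ, ℝ) ∞ ψ) (hψc : HasCompactSupport ψ) (hψ0 : ∀ x, 0 ≤ ψ x)
    (hψV : tsupport ψ ⊆ V) (hχ : IsCutoff δ χ) (hδ : η < δ) :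
    ∫ x in {x | η < u x}, χ (u x) * (b x * K * l ‖grad (m := m) u x‖ * ψ x)
        ∂(riemannianMeasure m M) ≤
      - ∫ x in {x | η < u x}, χ (u x) * fluxDensity (m := m) φ u ψ x
        ∂(riemannianMeasure m M) := by
  set μ := riemannianMeasure m M with hμ
  set Ω := {x | η < u x} with hΩ
  have huc : Continuous u := hu.continuous
  -- Smooth, hence legitimate, substitutes for the Lipschitz test function `χ(u)ψ`.
  set τ : ℕ → M → ℝ := fun n x => χ (w n x) * ψ x with hτ
  have hτs : ∀ n, ContMDiff (𝓡 m) 𝓘(ℝ, ℝ) ∞ (τ n) := fun n =>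
    contMDiff_cutoff_mul h.isOpen (h.contMDiffOn n) hχ.contDiff hψ hψV
  have hτc : ∀ n, HasCompactSupport (τ n) := fun n => hψc.mul_left
  have hτ0 : ∀ n x, 0 ≤ τ n x := fun n x => mul_nonneg (hχ.nonneg _) (hψ0 x)
  have hψz : ∀ x, x ∉ V → ψ x = 0 := fun x hx =>
    image_eq_zero_of_notMem_tsupport fun h => hx (hψV h)
  have hfz : ∀ x, x ∉ V → fluxDensity (m := m) φ u ψ x = 0 := fun x hx =>
    fluxDensity_of_notMem_tsupport φ u fun h => hx (hψV h)
  have hfτz : ∀ n x, x ∉ V → fluxDensity (m := m) φ u (τ n) x = 0 := fun n x hx =>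
    fluxDensity_of_notMem_tsupport φ u fun h => hx (hψV (tsupport_mul_subset_right h))
  have hwlim : ∀ x ∈ V, Tendsto (fun n => w n x) atTop (𝓝 (u x)) := fun x hx =>
    h.tendsto.tendsto_at hx
  have hχd : Continuous (deriv χ) := hχ.contDiff.continuous_deriv (by simp)
  have hflux : ∀ n, ∀ x ∈ V, fluxDensity (m := m) φ u (τ n) x =
      χ (w n x) * fluxDensity (m := m) φ u ψ x +
        ψ x * deriv χ (w n x) * fluxDensity (m := m) φ u (w n) x := fun n x hx =>
    fluxDensity_cutoff_mul (((h.contMDiffOn n).contMDiffAt (h.isOpen.mem_nhds hx)).mdifferentiableAt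
      (by simp)) hχ.contDiff ((hψ x).mdifferentiableAt (by simp))
  -- the source terms
  have hint : Integrable (fun x => b x * K * l ‖grad (m := m) u x‖ * ψ x) μ := by
    have := integrable_mul_comp_norm_grad (m := m) hu hl
      (g := fun x => b x * K * ψ x) ((hb.mul continuous_const).mul hψ.continuous) hψc.mul_left
    refine this.congr (ae_of_all _ fun x => ?_)
    ring
  have hF : Tendsto (fun n => ∫ x in Ω, b x * K * l ‖grad (m := m) u x‖ * τ n x ∂μ) atTop
      (𝓝 (∫ x in Ω, χ (u x) * (b x * K * l ‖grad (m := m) u x‖ * ψ x) ∂μ)) := by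
    refine tendsto_integral_of_dominated_convergence
      (fun x => ‖b x * K * l ‖grad (m := m) u x‖ * ψ x‖) (fun n => ?_) hint.norm.integrableOn
      (fun n => ae_of_all _ fun x => ?_) (ae_of_all _ fun x => ?_)
    · have := integrable_mul_comp_norm_grad (m := m) hu hl
        (g := fun x => b x * K * τ n x) ((hb.mul continuous_const).mul (hτs n).continuous)
        (hτc n).mul_left
      refine (this.congr (ae_of_all _ fun x => ?_)).aestronglyMeasurable.restrict
      ring
    · have h1 : b x * K * l ‖grad (m := m) u x‖ * τ n x =
          χ (w n x) * (b x * K * l ‖grad (m := m) u x‖ * ψ x) := by simp only [hτ]; ring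
      rw [h1, norm_mul, Real.norm_of_nonneg (hχ.nonneg _)]
      exact mul_le_of_le_one_left (norm_nonneg _) (hχ.le_one _)
    · by_cases hx : x ∈ V
      · have h1 : Tendsto (fun n => χ (w n x) * (b x * K * l ‖grad (m := m) u x‖ * ψ x)) atTop
            (𝓝 (χ (u x) * (b x * K * l ‖grad (m := m) u x‖ * ψ x))) :=
          ((hχ.contDiff.continuous.tendsto _).comp (hwlim x hx)).mul_const _
        refine h1.congr fun n => ?_
        simp only [hτ]; ring
      · simp [hτ, hψz x hx]
  -- the flux terms
  obtain ⟨Bφ, hBφ⟩ := (isCompact_Icc (a := (0 : ℝ)) (b := C)).exists_bound_of_continuousOn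
      (hφ.mono Icc_subset_Ici_self)
  obtain ⟨Bψ, hBψ⟩ := exists_norm_grad_le (m := m) hψ hψc
  obtain ⟨P, hP⟩ := hψc.exists_bound_of_continuous hψ.continuous
  obtain ⟨D, hD⟩ := hχ.deriv_le
  -- Uniform bound for the two terms of the product rule; on `V`, which has finite measure, it is an
  -- integrable majorant.
  set R := Bφ * Bψ + P * D * (Bφ * C) with hR
  have hbound : ∀ n x, ‖fluxDensity (m := m) φ u (τ n) x‖ ≤ V.indicator (fun _ => R) x := by
    intro n x
    by_cases hx : x ∈ V
    · rw [indicator_of_mem hx, hflux n x hx]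
      have hφx : |φ ‖grad (m := m) u x‖| ≤ Bφ := hBφ _ ⟨norm_nonneg _, h.norm_limit_le x hx⟩
      have hBφ0 : 0 ≤ Bφ := (abs_nonneg _).trans hφx
      have h1 : |fluxDensity (m := m) φ u ψ x| ≤ Bφ * Bψ :=
        (abs_div_norm_mul_inner_le _ u x _).trans
          (mul_le_mul hφx (hBψ x) (norm_nonneg _) hBφ0)
      have h2 : |fluxDensity (m := m) φ u (w n) x| ≤ Bφ * C :=
        (abs_div_norm_mul_inner_le _ u x _).trans
          (mul_le_mul hφx (h.norm_le n x hx) (norm_nonneg _) hBφ0)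
      have h3 : |ψ x| ≤ P := hP x
      have h4 : |deriv χ (w n x)| ≤ D := by
        rw [abs_of_nonneg (hχ.deriv_nonneg _)]; exact hD _
      have h5 : |χ (w n x)| ≤ 1 := by
        rw [abs_of_nonneg (hχ.nonneg _)]; exact hχ.le_one _
      refine (norm_add_le _ _).trans (add_le_add ?_ ?_)
      · rw [norm_mul]
        calc _ ≤ 1 * (Bφ * Bψ) := mul_le_mul h5 h1 (abs_nonneg _) zero_le_one
          _ = _ := one_mul _
      · rw [norm_mul, norm_mul]
        exact mul_le_mul (mul_le_mul h3 h4 (abs_nonneg _) ((abs_nonneg _).trans h3)) h2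
          (abs_nonneg _) (mul_nonneg ((abs_nonneg _).trans h3) ((abs_nonneg _).trans h4))
    · rw [hfτz n x hx]
      simp [hx]
  have hRint : Integrable (V.indicator fun _ => R) μ :=
    (integrable_indicator_iff h.isOpen.measurableSet).2
      (integrableOn_const h.measure_lt_top.ne)
  set G : M → ℝ := V.indicator fun x => χ (u x) * fluxDensity (m := m) φ u ψ x +
        ψ x * deriv χ (u x) * fluxDensity (m := m) φ u u x with hG
  have hGlim : ∀ᵐ x ∂μ, Tendsto (fun n => fluxDensity (m := m) φ u (τ n) x) atTop (𝓝 (G x)) := by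
    filter_upwards [h.ae_tendsto] with x hx
    by_cases hxV : x ∈ V
    · rw [hG, indicator_of_mem hxV]
      simp_rw [hflux _ x hxV]
      refine Tendsto.add (((hχ.contDiff.continuous.tendsto _).comp (hwlim x hxV)).mul_const _)
        (((((hχd.tendsto _).comp (hwlim x hxV)).const_mul _)).mul ?_)
      simp only [fluxDensity, inner_grad_right]
      exact (hx hxV _).const_mul _
    · simp [hfτz _ x hxV, hG, hxV]
  have hmeas : ∀ n, AEStronglyMeasurable (fluxDensity (m := m) φ u (τ n)) μ := fun n =>
    (integrable_fluxDensity hu hφ (hτs n) (hτc n)).aestronglyMeasurable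
  have hGint : Integrable G μ := by
    refine hRint.mono' (aestronglyMeasurable_of_tendsto_ae atTop hmeas hGlim) ?_
    filter_upwards [hGlim] with x hx
    exact le_of_tendsto hx.norm (Eventually.of_forall fun n => hbound n x)
  have hGl : Tendsto (fun n => ∫ x in Ω, fluxDensity (m := m) φ u (τ n) x ∂μ) atTop
      (𝓝 (∫ x in Ω, G x ∂μ)) :=
    tendsto_integral_of_dominated_convergence _ (fun n => (hmeas n).restrict)
      hRint.integrableOn (fun n => ae_of_all _ fun x => hbound n x) (ae_restrict_of_ae hGlim)
  have hlim : ∫ x in Ω, χ (u x) * (b x * K * l ‖grad (m := m) u x‖ * ψ x) ∂μ ≤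
      - ∫ x in Ω, G x ∂μ := by
    refine le_of_tendsto_of_tendsto hF hGl.neg ?_
    filter_upwards [h.eventually_tsupport_subset huc hψV hχ hδ] with n hn
    exact hsub.2 (τ n) (hτs n) (hτc n) hn (hτ0 n)
  refine hlim.trans (neg_le_neg ?_)
  have hfint : Integrable (fun x => χ (u x) * fluxDensity (m := m) φ u ψ x) μ :=
    (integrable_fluxDensity hu hφ hψ hψc).bdd_mul (c := 1)
      (hχ.contDiff.continuous.comp huc).aestronglyMeasurable
      (ae_of_all _ fun x => by
        rw [Real.norm_of_nonneg (hχ.nonneg _)]; exact hχ.le_one _)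
  -- The other summand of `G` is `ψ χ'(u) φ(|∇u|)|∇u| ≥ 0`; discarding it is the whole point of a
  -- monotone cutoff.
  refine integral_mono hfint.integrableOn hGint.integrableOn fun x => ?_
  by_cases hx : x ∈ V
  · rw [hG, indicator_of_mem hx]
    refine le_add_of_nonneg_right (mul_nonneg (mul_nonneg (hψ0 x) (hχ.deriv_nonneg _)) ?_)
    exact mul_nonneg (div_nonneg (hφ0 _ (norm_nonneg _)) (norm_nonneg _)) real_inner_self_nonneg
  · simp [hG, hx, hfz x hx]

/-- A weak inequality on `{η < u}` may be tested with functions which are supported in a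
neighborhood where `u` can be smoothed, but not necessarily in `{η < u}`. -/
lemma IsSmoothing.setIntegral_le (h : IsSmoothing (m := m) u V C w)
    (hu : LocallyLipschitz u) (hφ : ContinuousOn φ (Ici 0)) (hφ0 : ∀ t, 0 ≤ t → 0 ≤ φ t)
    (hl : ContinuousOn l (Ici 0)) (hb : Continuous b)
    (hsub : IsSubsolution (m := m) φ b (fun _ => K) l {x | η < u x} u)
    (hψ : ContMDiff (𝓡 m) 𝓘(ℝ, ℝ) ∞ ψ) (hψc : HasCompactSupport ψ) (hψ0 : ∀ x, 0 ≤ ψ x)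
    (hψV : tsupport ψ ⊆ V) :
    ∫ x in {x | η < u x}, b x * K * l ‖grad (m := m) u x‖ * ψ x ∂(riemannianMeasure m M) ≤
      - ∫ x in {x | η < u x}, fluxDensity (m := m) φ u ψ x ∂(riemannianMeasure m M) := by
  obtain ⟨χ, hχ, hχ1⟩ := exists_isCutoff η
  have huc : Continuous u := hu.continuous
  have hΩ : MeasurableSet {x | η < u x} := (isOpen_lt continuous_const huc).measurableSet
  -- The cutoffs are bounded by `1` and tend to `1` pointwise on `{η < u}`, so dominated convergence
  -- removes them from both sides.
  have key : ∀ F : M → ℝ, Integrable F (riemannianMeasure m M) →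
      Tendsto (fun n => ∫ x in {x | η < u x}, χ n (u x) * F x ∂(riemannianMeasure m M)) atTop
        (𝓝 (∫ x in {x | η < u x}, F x ∂(riemannianMeasure m M))) := by
    intro F hF
    refine tendsto_integral_of_dominated_convergence (fun x => ‖F x‖) (fun n => ?_)
      hF.norm.integrableOn (fun n => ae_of_all _ fun x => ?_) ?_
    · obtain ⟨δ, -, h1⟩ := hχ n
      exact ((h1.contDiff.continuous.comp huc).aestronglyMeasurable.mul
        hF.aestronglyMeasurable).restrict
    · obtain ⟨δ, -, h1⟩ := hχ n
      rw [norm_mul, Real.norm_of_nonneg (h1.nonneg _)]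
      exact mul_le_of_le_one_left (norm_nonneg _) (h1.le_one _)
    · rw [ae_restrict_iff' hΩ]
      refine ae_of_all _ fun x hx => ?_
      simpa using (hχ1 (u x) hx).mul_const (F x)
  have hint : Integrable (fun x => b x * K * l ‖grad (m := m) u x‖ * ψ x)
      (riemannianMeasure m M) := by
    have := integrable_mul_comp_norm_grad (m := m) hu hl
      (g := fun x => b x * K * ψ x) ((hb.mul continuous_const).mul hψ.continuous) hψc.mul_left
    refine this.congr (ae_of_all _ fun x => ?_)
    ring
  refine le_of_tendsto_of_tendsto' (key _ hint)
    (key _ (integrable_fluxDensity hu hφ hψ hψc)).neg fun n => ?_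
  obtain ⟨δ, hδ, h1⟩ := hχ n
  exact h.setIntegral_cutoff_le hu hφ hφ0 hl hb hsub hψ hψc hψ0 hψV h1 hδ

end LocalInequality

/-! ### Global inequality and truncation -/

section Global

open Filter

variable {m : ℕ} {M : Type*} [EMetricSpace M] [ChartedSpace (EuclideanSpace ℝ (Fin m)) M]
  [IsManifold (𝓡 m) ∞ M] [RiemannianBundle (fun x : M => TangentSpace (𝓡 m) x)]
  {φ l f : ℝ → ℝ} {b u ψ : M → ℝ} {K η : ℝ}

lemma differential_finsetSum {ι : Type*} (s : Finset ι) {g : ι → M → ℝ} {x : M}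
    (hg : ∀ i ∈ s, MDifferentiableAt (𝓡 m) 𝓘(ℝ, ℝ) (g i) x) :
    MDifferentiableAt (𝓡 m) 𝓘(ℝ, ℝ) (∑ i ∈ s, g i) x ∧
      differential (m := m) (∑ i ∈ s, g i) x = ∑ i ∈ s, differential (m := m) (g i) x := by
  classical
  induction s using Finset.induction_on with
  | empty =>
    have h : HasMFDerivAt (𝓡 m) 𝓘(ℝ, ℝ) (0 : M → ℝ) x 0 := hasMFDerivAt_const 0 x
    rw [Finset.sum_empty, Finset.sum_empty]
    exact ⟨h.mdifferentiableAt, h.mfderiv⟩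
  | insert i s hi ih =>
    obtain ⟨h1, h2⟩ := ih fun j hj => hg j (Finset.mem_insert_of_mem hj)
    have h := (hg i (Finset.mem_insert_self i s)).hasMFDerivAt.add h1.hasMFDerivAt
    rw [Finset.sum_insert hi, Finset.sum_insert hi, ← h2]
    exact ⟨h.mdifferentiableAt, h.mfderiv⟩

lemma fluxDensity_sum {ι : Type*} (s : Finset ι) {g : ι → M → ℝ} {x : M}
    (hg : ∀ i ∈ s, MDifferentiableAt (𝓡 m) 𝓘(ℝ, ℝ) (g i) x) :
    fluxDensity (m := m) φ u (∑ i ∈ s, g i) x =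
      ∑ i ∈ s, fluxDensity (m := m) φ u (g i) x := by
  simp only [fluxDensity, inner_grad_right, (differential_finsetSum s hg).2, sum_apply, Finset.mul_sum]

lemma differential_sub_const (f : M → ℝ) (c : ℝ) (x : M) :
    differential (m := m) (fun y => f y - c) x = differential f x := by
  rw [differential_eq_fderiv f (mem_chart_source _ x),
    differential_eq_fderiv _ (mem_chart_source _ x)]
  congr 1
  exact fderiv_sub_const c

/-- The gradient vanishes at a global minimum. -/
lemma grad_eq_zero_of_forall_le {f : M → ℝ} {x : M} (h : ∀ y, f x ≤ f y) :
    grad (m := m) f x = 0 := by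
  have h1 : differential (m := m) f x = 0 := by
    rw [differential_eq_fderiv f (mem_chart_source _ x)]
    have h2 : IsLocalMin (f ∘ (chartAt (EuclideanSpace ℝ (Fin m)) x).symm)
        (chartAt (EuclideanSpace ℝ (Fin m)) x x) := by
      refine Eventually.of_forall fun z => ?_
      simp only [Function.comp]
      rw [(chartAt (EuclideanSpace ℝ (Fin m)) x).left_inv (mem_chart_source _ x)]
      exact h _
    rw [h2.fderiv_eq_zero, ContinuousLinearMap.zero_comp]
  refine ext_inner_right ℝ fun v => ?_
  rw [inner_grad_left, h1, inner_zero_left]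
  rfl

lemma grad_max_sub (u : M → ℝ) (hu : Continuous u) {x : M} (hx : η < u x) :
    grad (m := m) (fun y => max (u y - η) 0) x = grad u x := by
  have h : (fun y => max (u y - η) 0) =ᶠ[𝓝 x] fun y => u y - η := by
    filter_upwards [(isOpen_lt continuous_const hu).mem_nhds hx] with y hy
    exact max_eq_left (sub_nonneg.2 (le_of_lt hy))
  rw [grad_congr h]
  exact congrArg (InnerProductSpace.toDual ℝ (TangentSpace (𝓡 m) x)).symm
    (differential_sub_const u η x)

/-- Such an `x` is a global minimum of the truncation, so this holds at every point, with no almost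
everywhere statement about the level set `{u = η}`. -/
lemma grad_max_sub_eq_zero {x : M} (hx : u x ≤ η) :
    grad (m := m) (fun y => max (u y - η) 0) x = 0 :=
  grad_eq_zero_of_forall_le fun y => by
    rw [max_eq_right (sub_nonpos.2 hx)]
    exact le_max_right _ _

variable [MeasurableSpace M]

/-- In the definition of subsolutions, the integrals may be extended to the whole manifold. -/
lemma isSubsolution_iff {Ω : Set M} :
    IsSubsolution (m := m) φ b f l Ω u ↔ LocallyLipschitzOn Ω u ∧
      ∀ ψ : M → ℝ, ContMDiff (𝓡 m) 𝓘(ℝ, ℝ) ∞ ψ → HasCompactSupport ψ → tsupport ψ ⊆ Ω →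
        (∀ x, 0 ≤ ψ x) →
        ∫ x, b x * f (u x) * l ‖grad (m := m) u x‖ * ψ x ∂(riemannianMeasure m M) ≤
          - ∫ x, fluxDensity (m := m) φ u ψ x ∂(riemannianMeasure m M) := by
  refine and_congr_right fun _ => forall_congr' fun ψ => forall_congr' fun _ =>
    forall_congr' fun _ => forall_congr' fun hψ => forall_congr' fun _ => ?_
  have e1 : ∫ x in Ω, b x * f (u x) * l ‖grad (m := m) u x‖ * ψ x ∂(riemannianMeasure m M) =
      ∫ x, b x * f (u x) * l ‖grad (m := m) u x‖ * ψ x ∂(riemannianMeasure m M) := by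
    refine setIntegral_eq_integral_of_forall_compl_eq_zero fun x hx => ?_
    rw [image_eq_zero_of_notMem_tsupport fun h => hx (hψ h), mul_zero]
  have e2 : ∫ x in Ω, fluxDensity (m := m) φ u ψ x ∂(riemannianMeasure m M) =
      ∫ x, fluxDensity (m := m) φ u ψ x ∂(riemannianMeasure m M) :=
    setIntegral_eq_integral_of_forall_compl_eq_zero fun x hx =>
      fluxDensity_of_notMem_tsupport φ u fun h => hx (hψ h)
  rw [← e1, ← e2]
  rfl

lemma IsSubsolution.mono {Ω Ω' : Set M} (h : IsSubsolution (m := m) φ b f l Ω u)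
    (hΩ : Ω' ⊆ Ω) : IsSubsolution (m := m) φ b f l Ω' u := by
  rw [isSubsolution_iff] at h ⊢
  exact ⟨h.1.mono hΩ, fun ψ h1 h2 h3 h4 => h.2 ψ h1 h2 (h3.trans hΩ) h4⟩

variable [IsContinuousRiemannianBundle (EuclideanSpace ℝ (Fin m)) (fun x : M => TangentSpace (𝓡 m) x)]
  [IsRiemannianManifold (𝓡 m) M] [BorelSpace M]

lemma integrable_source (hu : LocallyLipschitz u) (hl : ContinuousOn l (Ici 0)) {g : M → ℝ}
    (hg : Continuous g) (hψ : Continuous ψ) (hψc : HasCompactSupport ψ) :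
    Integrable (fun x => g x * l ‖grad (m := m) u x‖ * ψ x) (riemannianMeasure m M) := by
  have := integrable_mul_comp_norm_grad (m := m) hu hl
    (g := fun x => g x * ψ x) (hg.mul hψ) hψc.mul_left
  refine this.congr (ae_of_all _ fun x => ?_)
  ring

/-- Passage to a constant right-hand side on an open set where `f(u) ≥ K`. -/
lemma IsSubsolution.const_of_le {Ω Ω' : Set M} {v : M → ℝ}
    (h : IsSubsolution (m := m) φ b f l Ω u) (hΩ : Ω' ⊆ Ω) (hΩ' : IsOpen Ω')
    (hv : LocallyLipschitz v) (huv : EqOn v u Ω') (hf : Continuous f)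
    (hK : ∀ x ∈ Ω', K ≤ f (u x)) (hb : Continuous b) (hb0 : ∀ x, 0 ≤ b x)
    (hl : ContinuousOn l (Ici 0)) (hl0 : ∀ t, 0 ≤ t → 0 ≤ l t) :
    IsSubsolution (m := m) φ b (fun _ => K) l Ω' v := by
  rw [isSubsolution_iff] at h ⊢
  refine ⟨hv.locallyLipschitzOn, fun ψ h1 h2 h3 h4 => ?_⟩
  have hgrad : ∀ x ∈ Ω', grad (m := m) v x = grad u x := fun x hx =>
    grad_congr (huv.eventuallyEq_of_mem (hΩ'.mem_nhds hx))
  have hz : ∀ x, x ∉ Ω' → ψ x = 0 := fun x hx =>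
    image_eq_zero_of_notMem_tsupport fun h => hx (h3 h)
  have hflux : fluxDensity (m := m) φ v ψ = fluxDensity (m := m) φ u ψ := by
    ext x
    by_cases hx : x ∈ Ω'
    · simp only [fluxDensity, hgrad x hx]
    · rw [fluxDensity_of_notMem_tsupport φ u fun h => hx (h3 h),
        fluxDensity_of_notMem_tsupport φ v fun h => hx (h3 h)]
  have hsrc : (fun x => b x * f (u x) * l ‖grad (m := m) u x‖ * ψ x) =
      fun x => b x * f (v x) * l ‖grad (m := m) v x‖ * ψ x := by
    ext x
    by_cases hx : x ∈ Ω'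
    · rw [hgrad x hx, huv hx]
    · rw [hz x hx, mul_zero, mul_zero]
  -- Everything is rewritten in terms of `v`, which is locally Lipschitz on all of `M`, so that the
  -- integrability lemmas apply; `u` is controlled only on `Ω`.
  have hle := h.2 ψ h1 h2 (h3.trans hΩ) h4
  rw [← hflux, hsrc] at hle
  refine le_trans (integral_mono
    (integrable_source hv hl (hb.mul continuous_const) h1.continuous h2)
    (integrable_source hv hl (hb.mul (hf.comp hv.continuous)) h1.continuous h2) fun x => ?_) hle
  by_cases hx : x ∈ Ω'
  · have h5 : K ≤ f (v x) := by rw [huv hx]; exact hK x hx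
    have h6 := hl0 _ (norm_nonneg (grad (m := m) v x))
    have h7 := hb0 x
    have h8 := h4 x
    exact mul_le_mul_of_nonneg_right (mul_le_mul_of_nonneg_right
      (mul_le_mul_of_nonneg_left h5 h7) h6) h8
  · simp [hz x hx]

variable [SecondCountableTopology M]

/-- A weak inequality on `{η < u}` may be tested with functions which are not supported in
`{η < u}`. -/
lemma IsSubsolution.setIntegral_superlevel_le (hu : LocallyLipschitz u)
    (hφ : ContinuousOn φ (Ici 0)) (hφ0 : ∀ t, 0 ≤ t → 0 ≤ φ t)
    (hl : ContinuousOn l (Ici 0)) (hb : Continuous b)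
    (hsub : IsSubsolution (m := m) φ b (fun _ => K) l {x | η < u x} u)
    (hψ : ContMDiff (𝓡 m) 𝓘(ℝ, ℝ) ∞ ψ) (hψc : HasCompactSupport ψ) (hψ0 : ∀ x, 0 ≤ ψ x) :
    ∫ x in {x | η < u x}, b x * K * l ‖grad (m := m) u x‖ * ψ x ∂(riemannianMeasure m M) ≤
      - ∫ x in {x | η < u x}, fluxDensity (m := m) φ u ψ x ∂(riemannianMeasure m M) := by
  have : LocallyCompactSpace M := ChartedSpace.locallyCompactSpace (EuclideanSpace ℝ (Fin m)) M
  choose V C w hxV hV using exists_isSmoothing (m := m) hu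
  -- Both sides are additive in `ψ`, so it suffices to split `ψ` into finitely many pieces supported
  -- where `u` can be smoothed.
  obtain ⟨ρ, hρ⟩ := SmoothPartitionOfUnity.exists_isSubordinate (𝓡 m) (isClosed_univ (X := M)) V
    (fun x => (hV x).isOpen) fun x _ => mem_iUnion.2 ⟨x, hxV x⟩
  have hfin : {i | (Function.support (ρ i) ∩ tsupport ψ).Nonempty}.Finite :=
    ρ.locallyFinite.finite_nonempty_inter_compact hψc
  set F := hfin.toFinset with hF
  set g : M → M → ℝ := fun i => ρ i * ψ with hg
  have hgs : ∀ i, ContMDiff (𝓡 m) 𝓘(ℝ, ℝ) ∞ (g i) := fun i => (ρ i).contMDiff.mul hψ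
  have hgc : ∀ i, HasCompactSupport (g i) := fun i => hψc.mul_left
  have hg0 : ∀ i x, 0 ≤ g i x := fun i x => mul_nonneg (ρ.nonneg i x) (hψ0 x)
  have hgV : ∀ i, tsupport (g i) ⊆ V i := fun i => tsupport_mul_subset_left.trans (hρ i)
  have hsum : ψ = ∑ i ∈ F, g i := by
    ext x
    rw [Finset.sum_apply]
    simp only [hg, Pi.mul_apply]
    rw [← Finset.sum_mul]
    by_cases hx : x ∈ tsupport ψ
    · have h1 := ρ.sum_eq_one (mem_univ x)
      rw [finsum_eq_sum_of_support_subset (s := F)] at h1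
      · rw [h1, one_mul]
      · intro i hi
        simp only [hF, Set.Finite.coe_toFinset]
        exact ⟨x, hi, hx⟩
    · rw [image_eq_zero_of_notMem_tsupport hx, mul_zero]
  have hI1 : ∫ x in {x | η < u x}, b x * K * l ‖grad (m := m) u x‖ * ψ x
      ∂(riemannianMeasure m M) = ∑ i ∈ F, ∫ x in {x | η < u x},
        b x * K * l ‖grad (m := m) u x‖ * g i x ∂(riemannianMeasure m M) := by
    rw [← integral_finsetSum]
    · refine integral_congr_ae (ae_of_all _ fun x => ?_)
      simp only
      rw [← Finset.mul_sum, ← Finset.sum_apply, ← hsum]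
    · exact fun i _ => (integrable_source hu hl (hb.mul continuous_const)
        (hgs i).continuous (hgc i)).integrableOn
  have hI2 : ∫ x in {x | η < u x}, fluxDensity (m := m) φ u ψ x
      ∂(riemannianMeasure m M) = ∑ i ∈ F, ∫ x in {x | η < u x},
        fluxDensity (m := m) φ u (g i) x ∂(riemannianMeasure m M) := by
    rw [← integral_finsetSum]
    · refine integral_congr_ae (ae_of_all _ fun x => ?_)
      simp only
      rw [← fluxDensity_sum, ← hsum]
      exact fun i _ => (hgs i x).mdifferentiableAt (by simp)
    · exact fun i _ => (integrable_fluxDensity hu hφ (hgs i) (hgc i)).integrableOn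
  rw [hI1, hI2, ← Finset.sum_neg_distrib]
  exact Finset.sum_le_sum fun i _ =>
    (hV i).setIntegral_le hu hφ hφ0 hl hb hsub (hgs i) (hgc i) (hg0 i) (hgV i)

/-- If `u` satisfies the weak inequality with constant right-hand side `K` on `{η < u}`, then
`(u - η)⁺` is a subsolution on the whole manifold for any `f` with `f 0 = 0` which takes values in
`[0, K]` on the range of `(u - η)⁺`. -/
lemma IsSubsolution.max_sub (hu : LocallyLipschitz u)
    (hφ : ContinuousOn φ (Ici 0)) (hφ0 : ∀ t, 0 ≤ t → 0 ≤ φ t)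
    (hl : ContinuousOn l (Ici 0)) (hl0 : ∀ t, 0 ≤ t → 0 ≤ l t)
    (hb : Continuous b) (hb0 : ∀ x, 0 ≤ b x)
    (hsub : IsSubsolution (m := m) φ b (fun _ => K) l {x | η < u x} u)
    (hf0 : f 0 = 0) (hf : ∀ x, η < u x → f (u x - η) ∈ Icc 0 K) :
    IsSubsolution (m := m) φ b f l univ (fun x => max (u x - η) 0) := by
  have huc : Continuous u := hu.continuous
  have hΩ : MeasurableSet {x | η < u x} := (isOpen_lt continuous_const huc).measurableSet
  have hv : LocallyLipschitz fun x => max (u x - η) 0 := by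
    have h1 : LocallyLipschitz fun x => u x + -η := hu.add (.const _)
    simpa only [sub_eq_add_neg] using h1.max_const 0
  rw [isSubsolution_iff]
  refine ⟨hv.locallyLipschitzOn, fun ψ h1 h2 _ h4 => ?_⟩
  have hsrc : ∫ x, b x * f (max (u x - η) 0) *
      l ‖grad (m := m) (fun x => max (u x - η) 0) x‖ * ψ x ∂(riemannianMeasure m M) =
      ∫ x in {x | η < u x}, b x * f (u x - η) * l ‖grad (m := m) u x‖ * ψ x
        ∂(riemannianMeasure m M) := by
    rw [← setIntegral_eq_integral_of_forall_compl_eq_zero (s := {x | η < u x})]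
    · refine setIntegral_congr_fun hΩ fun x hx => ?_
      rw [grad_max_sub u huc hx, max_eq_left (sub_nonneg.2 (le_of_lt hx))]
    · intro x hx
      rw [max_eq_right (sub_nonpos.2 (not_lt.1 hx)), hf0]
      simp
  have hflux : ∫ x, fluxDensity (m := m) φ (fun x => max (u x - η) 0) ψ x
      ∂(riemannianMeasure m M) =
      ∫ x in {x | η < u x}, fluxDensity (m := m) φ u ψ x ∂(riemannianMeasure m M) := by
    rw [← setIntegral_eq_integral_of_forall_compl_eq_zero (s := {x | η < u x})]
    · refine setIntegral_congr_fun hΩ fun x hx => ?_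
      simp only [fluxDensity]
      rw [grad_max_sub u huc hx]
    · intro x hx
      rw [fluxDensity, grad_max_sub_eq_zero (not_lt.1 hx)]
      simp
  rw [hsrc, hflux]
  refine le_trans ?_ (hsub.setIntegral_superlevel_le hu hφ hφ0 hl hb h1 h2 h4)
  have hl' : ∀ x, 0 ≤ l ‖grad (m := m) u x‖ := fun x => hl0 _ (norm_nonneg _)
  -- Nonnegativity of the smaller integrand replaces its integrability, as `f` is not assumed
  -- continuous here.
  refine integral_mono_of_nonneg ?_ (integrable_source hu hl (hb.mul continuous_const)
    h1.continuous h2).integrableOn ?_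
  · rw [EventuallyLE, ae_restrict_iff' hΩ]
    exact ae_of_all _ fun x hx => mul_nonneg (mul_nonneg (mul_nonneg (hb0 x) (hf x hx).1)
      (hl' x)) (h4 x)
  · rw [EventuallyLE, ae_restrict_iff' hΩ]
    refine ae_of_all _ fun x hx => ?_
    exact mul_le_mul_of_nonneg_right (mul_le_mul_of_nonneg_right
      (mul_le_mul_of_nonneg_left (hf x hx).2 (hb0 x)) (hl' x)) (h4 x)

end Global

/-! ### The implications between the properties -/

section Equivalence

open Filter

variable {m : ℕ} {M : Type*} [EMetricSpace M] [ChartedSpace (EuclideanSpace ℝ (Fin m)) M]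
  [IsManifold (𝓡 m) ∞ M] [RiemannianBundle (fun x : M => TangentSpace (𝓡 m) x)]
  [MeasurableSpace M] {φ l f : ℝ → ℝ} {b : M → ℝ}

lemma isAdmissible_id : IsAdmissible (fun t => t) :=
  ⟨continuous_id, rfl, fun _ h => h⟩

lemma NonConstant.exists_lt_iSup {u : M → ℝ} (hu : NonConstant u) (hbdd : BddAbove (range u)) :
    ∃ x, u x < ⨆ y, u y := by
  by_contra! h
  exact hu ⟨⨆ y, u y, fun x => le_antisymm (le_ciSup hbdd x) (h x)⟩

/-- A non-negative bounded non-constant solution violates the estimate of its supremum. -/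
lemma SupEstimate.liouville (hf : IsAdmissible f) (h : SupEstimate (M := M) m φ b f l) :
    Liouville (M := M) m φ b f l := by
  rintro ⟨u, hu, hu0, hnc, C, hC⟩
  have hbdd : BddAbove (range u) := ⟨C, by rintro _ ⟨x, rfl⟩; exact (le_abs_self _).trans (hC x)⟩
  obtain ⟨x, hx⟩ := hnc.exists_lt_iSup hbdd
  exact absurd (h u hu hnc hbdd) (not_le.2 (hf.pos _ ((hu0 x).trans_lt hx)))

lemma OWMP.wmp [PreconnectedSpace M] (h : OWMP (M := M) m φ b l) : WMP (M := M) m φ b l := by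
  intro u hu hnc hbdd η hη K hsub
  by_contra! hK
  obtain ⟨p, hp⟩ := hnc.exists_lt_iSup hbdd
  -- Raising the level to `u p` leaves `p` outside the superlevel set; being nonempty and proper,
  -- the set has a frontier by connectedness, and there `u ≤ η'`.
  set η' := max η (u p) with hη'
  have huc : Continuous u := hu.continuous
  have hΩ : IsOpen {x | η' < u x} := isOpen_lt continuous_const huc
  have : Nonempty M := ⟨p⟩
  obtain ⟨q, hq⟩ := exists_lt_of_lt_ciSup (max_lt hη hp : η' < ⨆ x, u x)
  have hpΩ : p ∉ {x | η' < u x} := not_lt.2 (le_max_right η (u p))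
  have hfr : (frontier {x | η' < u x}).Nonempty := by
    rw [nonempty_frontier_iff]
    exact ⟨⟨q, hq⟩, fun huniv => hpΩ (huniv ▸ mem_univ p)⟩
  have hbdd' : BddAbove (u '' {x | η' < u x}) := hbdd.mono (image_subset_range _ _)
  have hsub' : IsSubsolution (m := m) φ b (fun _ => K) l {x | η' < u x} u :=
    hsub.mono fun x hx => (le_max_left η (u p)).trans_lt hx
  rcases h (fun _ => K) continuous_const _ hΩ hfr u huc.continuousOn hsub' hbdd' with h1 | h1
  · have h2 : sSup (u '' frontier {x | η' < u x}) ≤ η' := by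
      refine csSup_le (hfr.image u) ?_
      rintro _ ⟨x, hx, rfl⟩
      exact not_lt.1 fun hlt => (hΩ.frontier_eq ▸ hx).2 hlt
    have h3 : u q ≤ sSup (u '' {x | η' < u x}) := le_csSup hbdd' ⟨q, hq, rfl⟩
    have h4 : η' < u q := hq
    linarith
  · exact absurd h1 (not_le.2 hK)

variable [IsContinuousRiemannianBundle (EuclideanSpace ℝ (Fin m)) (fun x : M => TangentSpace (𝓡 m) x)]
  [IsRiemannianManifold (𝓡 m) M] [BorelSpace M]

/-- If `f` is positive at the supremum, continuity gives the lower bound `f(u*)/2` on a superlevel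
set, and this positive constant contradicts the weak maximum principle. -/
lemma WMP.supEstimate (h : WMP (M := M) m φ b l) (hf : Continuous f) (hb : Continuous b)
    (hb0 : ∀ x, 0 ≤ b x) (hl : ContinuousOn l (Ici 0)) (hl0 : ∀ t, 0 ≤ t → 0 ≤ l t) :
    SupEstimate (M := M) m φ b f l := by
  intro u hu hnc hbdd
  by_contra! hpos
  set S := ⨆ x, u x with hS
  have hul : LocallyLipschitz u := locallyLipschitzOn_univ.1 hu.1
  obtain ⟨ε, hε, hball⟩ := Metric.eventually_nhds_iff_ball.1
    (hf.continuousAt.eventually_const_lt (half_lt_self hpos))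
  have hη : S - ε < S := by linarith
  have hsub : IsSubsolution (m := m) φ b (fun _ => f S / 2) l {x | S - ε < u x} u := by
    refine hu.const_of_le (subset_univ _) (isOpen_lt continuous_const hul.continuous) hul
      (fun x _ => rfl) hf (fun x hx => ?_) hb hb0 hl hl0
    have h1 : u x ≤ S := le_ciSup hbdd x
    have h2 : S - ε < u x := hx
    refine (hball (u x) ?_).le
    rw [Metric.mem_ball, Real.dist_eq, abs_lt]
    exact ⟨by linarith, by linarith⟩
  linarith [h u hul hnc hbdd _ hη _ hsub]

lemma WMP.owmp (h : WMP (M := M) m φ b l) (hb : Continuous b)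
    (hb0 : ∀ x, 0 ≤ b x) (hl : ContinuousOn l (Ici 0)) (hl0 : ∀ t, 0 ≤ t → 0 ≤ l t) :
    OWMP (M := M) m φ b l := by
  classical
  intro f hf Ω hΩ hfr u huc hu hbdd
  by_contra! hcon
  obtain ⟨hne, hpos⟩ := hcon
  set S := sSup (u '' Ω) with hS
  have hcl : ∀ x ∈ closure Ω, u x ≤ S := by
    have h1 : u '' closure Ω ⊆ Iic S :=
      huc.image_closure.trans (closure_minimal (fun y hy => le_csSup hbdd hy) isClosed_Iic)
    exact fun x hx => h1 ⟨x, hx, rfl⟩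
  have hbdd' : BddAbove (u '' frontier Ω) :=
    ⟨S, by rintro _ ⟨x, hx, rfl⟩; exact hcl x (frontier_subset_closure hx)⟩
  have hlt : sSup (u '' frontier Ω) < S := by
    refine lt_of_le_of_ne (csSup_le (hfr.image u) ?_) hne.symm
    rintro _ ⟨x, hx, rfl⟩
    exact hcl x (frontier_subset_closure hx)
  have hΩne : Ω.Nonempty := by
    obtain ⟨x, hx⟩ := hfr
    exact closure_nonempty_iff.1 ⟨x, frontier_subset_closure hx⟩
  obtain ⟨ε, hε, hball⟩ := Metric.eventually_nhds_iff_ball.1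
    (hf.continuousAt.eventually_const_lt (half_lt_self hpos))
  obtain ⟨η, hη1, hη2⟩ := exists_between (max_lt hlt (by linarith : S - ε < S))
  have hηfr : sSup (u '' frontier Ω) < η := (le_max_left _ _).trans_lt hη1
  have hηε : S - ε < η := (le_max_right _ _).trans_lt hη1
  -- As `η` exceeds the supremum over the frontier, `v` equals `η` near every point outside `Ω`: the
  -- gluing stays locally Lipschitz and `{η < v}` lies in `Ω`.
  set v : M → ℝ := fun x => if x ∈ Ω then max (u x) η else η with hv
  have hvΩ : ∀ x ∈ Ω, v x = max (u x) η := fun x hx => if_pos hx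
  have hvΩc : ∀ x ∉ Ω, v x = η := fun x hx => if_neg hx
  have hvl : LocallyLipschitz v := by
    intro x
    by_cases hx : x ∈ Ω
    · obtain ⟨A, t, ht, hA⟩ := hu.1 hx
      rw [hΩ.nhdsWithin_eq hx] at ht
      refine ⟨A, t ∩ Ω, inter_mem ht (hΩ.mem_nhds hx), ?_⟩
      have h1 : LipschitzOnWith A (fun y => max (u y) η) (t ∩ Ω) := by
        have h2 : LipschitzWith 1 fun s : ℝ => max s η := LipschitzWith.id.max_const η
        simpa [Function.comp_def] using h2.comp_lipschitzOnWith (hA.mono inter_subset_left)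
      intro y hy z hz
      rw [hvΩ y hy.2, hvΩ z hz.2]
      exact h1 hy hz
    · have hev : ∀ᶠ y in 𝓝 x, v y = η := by
        have h1 : ∀ᶠ y in 𝓝 x, y ∈ closure Ω → u y < η := by
          by_cases hxc : x ∈ closure Ω
          · have h2 : u x < η :=
              (le_csSup hbdd' ⟨x, hΩ.frontier_eq ▸ ⟨hxc, hx⟩, rfl⟩).trans_lt hηfr
            exact eventually_nhdsWithin_iff.1 ((huc x hxc).eventually_lt_const h2)
          · filter_upwards [isClosed_closure.isOpen_compl.mem_nhds hxc] with y hy hy'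
            exact absurd hy' hy
        filter_upwards [h1] with y hy
        by_cases hyΩ : y ∈ Ω
        · rw [hvΩ y hyΩ, max_eq_right (hy (subset_closure hyΩ)).le]
        · exact hvΩc y hyΩ
      refine ⟨0, {y | v y = η}, hev, fun y hy z hz => ?_⟩
      have hy' : v y = η := hy
      have hz' : v z = η := hz
      rw [hy', hz']
      simp
  have hvS : ∀ x, v x ≤ S := by
    intro x
    by_cases hx : x ∈ Ω
    · rw [hvΩ x hx]
      exact max_le (hcl x (subset_closure hx)) hη2.le
    · rw [hvΩc x hx]
      exact hη2.le
  have hvbdd : BddAbove (range v) := ⟨S, by rintro _ ⟨x, rfl⟩; exact hvS x⟩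
  obtain ⟨_, ⟨q, hqΩ, rfl⟩, hq⟩ := exists_lt_of_lt_csSup (hΩne.image u) hη2
  have hvq : η < v q := by
    rw [hvΩ q hqΩ]
    exact hq.trans_le (le_max_left _ _)
  have hmem : ∀ x, η < v x → x ∈ Ω := fun x hx => by
    by_contra hxΩ
    exact hx.ne' (hvΩc x hxΩ)
  have hvu : EqOn v u {x | η < v x} := fun x hx => by
    have h1 : η < v x := hx
    rw [hvΩ x (hmem x hx)] at h1 ⊢
    exact max_eq_left ((lt_max_iff.1 h1).resolve_right (lt_irrefl η)).le
  have hvnc : NonConstant v := by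
    rintro ⟨c, hc⟩
    obtain ⟨p, hp⟩ := hfr
    have h1 : v p = η := hvΩc p (hΩ.frontier_eq ▸ hp).2
    rw [hc] at h1 hvq
    linarith
  have hsub : IsSubsolution (m := m) φ b (fun _ => f S / 2) l {x | η < v x} v := by
    refine hu.const_of_le hmem (isOpen_lt continuous_const hvl.continuous) hvl
      hvu hf (fun x hx => ?_) hb hb0 hl hl0
    have h1 : v x ≤ S := hvS x
    have h2 : η < v x := hx
    rw [← hvu hx]
    refine (hball (v x) ?_).le
    rw [Metric.mem_ball, Real.dist_eq, abs_lt]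
    exact ⟨by linarith, by linarith⟩
  linarith [h v hvl hvnc hvbdd η (hvq.trans_le (le_ciSup hvbdd q)) _ hsub]

lemma Liouville.wmp [SecondCountableTopology M] (hf : IsAdmissible f)
    (h : Liouville (M := M) m φ b f l)
    (hφ : ContinuousOn φ (Ici 0)) (hφ0 : ∀ t, 0 ≤ t → 0 ≤ φ t)
    (hl : ContinuousOn l (Ici 0)) (hl0 : ∀ t, 0 ≤ t → 0 ≤ l t)
    (hb : Continuous b) (hb0 : ∀ x, 0 ≤ b x) : WMP (M := M) m φ b l := by
  intro u hu hnc hbdd η hη K hsub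
  by_contra! hK
  set S := ⨆ x, u x with hS
  have hfK : ∀ᶠ t in 𝓝 (0 : ℝ), f t < K :=
    hf.continuous.continuousAt.eventually_lt_const (by rwa [hf.zero])
  obtain ⟨ε, hε, hball⟩ := Metric.eventually_nhds_iff_ball.1 hfK
  -- With `η' > S - ε`, the values of `(u - η')⁺` lie in `[0, ε)`, where `f < K` because `f 0 = 0 <
  -- K`.
  obtain ⟨η', hη1, hη2⟩ := exists_between (max_lt hη (by linarith : S - ε < S))
  have hle : ∀ x, u x ≤ S := le_ciSup hbdd
  have hηε : S - ε < η' := (le_max_right _ _).trans_lt hη1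
  have hsub' : IsSubsolution (m := m) φ b (fun _ => K) l {x | η' < u x} u :=
    hsub.mono fun x hx => ((le_max_left _ _).trans_lt hη1).trans hx
  have hv := hsub'.max_sub hu hφ hφ0 hl hl0 hb hb0 hf.zero fun x hx => by
    have h1 : 0 < u x - η' := sub_pos.2 hx
    refine ⟨(hf.pos _ h1).le, (hball _ ?_).le⟩
    rw [Metric.mem_ball, Real.dist_eq, sub_zero, abs_of_pos h1]
    linarith [hle x]
  obtain ⟨p, hp⟩ := hnc.exists_lt_iSup hbdd
  have : Nonempty M := ⟨p⟩
  obtain ⟨q, hq⟩ := exists_lt_of_lt_ciSup (hη2 : η' < ⨆ x, u x)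
  refine h ⟨_, hv, fun x => le_max_right _ _, ?_, S - η', fun x => ?_⟩
  · rintro ⟨c, hc⟩
    refine hnc ⟨c + η', fun x => ?_⟩
    have hcpos : 0 < c := by
      rw [← hc q]
      exact lt_max_of_lt_left (sub_pos.2 hq)
    have hx : max (u x - η') 0 = c := hc x
    rcases le_total (u x - η') 0 with h1 | h1
    · rw [max_eq_right h1] at hx
      linarith
    · rw [max_eq_left h1] at hx
      linarith
  · rw [abs_of_nonneg (le_max_right _ _)]
    exact max_le (by linarith [hle x]) (by linarith)

end Equivalence

end PhiLaplace

end

/-! ### The main theorem -/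

theorem mainTheorem10 {m : ℕ} (hm : 2 ≤ m)
    {M : Type*} [EMetricSpace M] [ChartedSpace (EuclideanSpace ℝ (Fin m)) M]
    [IsManifold (𝓡 m) ∞ M] [RiemannianBundle (fun x : M => TangentSpace (𝓡 m) x)]
    [IsContMDiffRiemannianBundle (𝓡 m) ∞ (EuclideanSpace ℝ (Fin m))
      (fun x : M => TangentSpace (𝓡 m) x)]
    [IsRiemannianManifold (𝓡 m) M]
    [SecondCountableTopology M] [ConnectedSpace M] [NoncompactSpace M]
    [MeasurableSpace M] [BorelSpace M]
    (φ : ℝ → ℝ) (hφ : ContinuousOn φ (Ici 0)) (hφ0 : φ 0 = 0) (hφpos : ∀ t, 0 < t → 0 < φ t)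
    (b : M → ℝ) (hb : Continuous b) (hbpos : ∀ x, 0 < b x)
    (l : ℝ → ℝ) (hl : ContinuousOn l (Ici 0)) (hlpos : ∀ t, 0 < t → 0 < l t) :
    List.TFAE [
      PhiLaplace.WMP m φ b l,
      ∃ f : ℝ → ℝ, PhiLaplace.IsAdmissible f ∧ PhiLaplace.Liouville m φ b f l,
      ∀ f : ℝ → ℝ, PhiLaplace.IsAdmissible f → PhiLaplace.Liouville m φ b f l,
      ∃ f : ℝ → ℝ, PhiLaplace.IsAdmissible f ∧ PhiLaplace.SupEstimate m φ b f l,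
      ∀ f : ℝ → ℝ, Continuous f → PhiLaplace.SupEstimate m φ b f l,
      PhiLaplace.OWMP m φ b l] := by
  have hbundle : IsContinuousRiemannianBundle (EuclideanSpace ℝ (Fin m))
      (fun x : M => TangentSpace (𝓡 m) x) := by
    obtain ⟨g, hg, hg'⟩ := IsContMDiffRiemannianBundle.exists_contMDiff (IB := 𝓡 m) (n := ∞)
      (F := EuclideanSpace ℝ (Fin m)) (E := fun x : M => TangentSpace (𝓡 m) x)
    exact ⟨g, hg.continuous, hg'⟩
  have hφ' : ∀ t, 0 ≤ t → 0 ≤ φ t := fun t ht => by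
    rcases ht.eq_or_lt with rfl | ht
    · exact hφ0.ge
    · exact (hφpos t ht).le
  have hl' : ∀ t, 0 ≤ t → 0 ≤ l t := by
    -- Positivity is assumed only on `(0, ∞)`; at `0` continuity from the right leaves `l 0 ≥ 0`.
    have h0 : 0 ≤ l 0 :=
      ge_of_tendsto ((hl 0 self_mem_Ici).mono_left (nhdsWithin_mono 0 Ioi_subset_Ici_self))
        (Filter.eventually_of_mem self_mem_nhdsWithin fun t ht => (hlpos t ht).le)
    intro t ht
    rcases ht.eq_or_lt with rfl | ht
    · exact h0
    · exact (hlpos t ht).le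
  have hb' : ∀ x, 0 ≤ b x := fun x => (hbpos x).le
  tfae_have 1 → 5 := fun h f hf => h.supEstimate hf hb hb' hl hl'
  tfae_have 5 → 4 := fun h => ⟨_, PhiLaplace.isAdmissible_id, h _ continuous_id⟩
  tfae_have 4 → 2 := fun ⟨f, hf, h⟩ => ⟨f, hf, h.liouville hf⟩
  tfae_have 5 → 3 := fun h f hf => (h f hf.continuous).liouville hf
  tfae_have 3 → 2 := fun h => ⟨_, PhiLaplace.isAdmissible_id, h _ PhiLaplace.isAdmissible_id⟩
  tfae_have 2 → 1 := fun ⟨f, hf, h⟩ => h.wmp hf hφ hφ' hl hl' hb hb'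
  tfae_have 1 → 6 := fun h => h.owmp hb hb' hl hl'
  tfae_have 6 → 1 := fun h => h.wmp
  tfae_finish
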